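/- Let $M$ be a smooth manifold. A complex structure on $M$ is a smooth, fibrewise linear map $J\colon TM\to TM$ over the identity of $M$ with $J^2=-1$ that is integrable, i.e. $$[JX,JY]-[X,Y]-J[JX,Y]-J[X,JY]=0$$ for all smooth vector fields $X,Y$ on $M$. A hypercomplex structure on $M$ is a triple $(I,J,K)$ of complex structures on $M$ with $IJ=-JI=K$. A hypercomplex structure on a Lie group $G$ is called homogeneous (left-invariant) if $I$, $J$ and $K$ commute with the differentials of all left translations $L_g\colon G\to G$, $g\in G$. For every integer $m>1$, the real Lie group underlying $SL(2m-1,\mathbb{C})$ admits a homogeneous hypercomplex structure. -/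

import Mathlib

open scoped Manifold ContDiff

noncomputable section

/-! ### Complex and hypercomplex structures on a manifold -/

section Manifolds

variable {E : Type*} [NormedAddCommGroup E] [NormedSpace ℝ E]
  {M : Type*} [TopologicalSpace M] [ChartedSpace E M]

/-- A field of endomorphisms of the tangent spaces of `M` (no regularity is required). -/
abbrev TangentEndo (E : Type*) [NormedAddCommGroup E] [NormedSpace ℝ E]
    (M : Type*) [TopologicalSpace M] [ChartedSpace E M] :=
  ∀ x : M, TangentSpace 𝓘(ℝ, E) x →L[ℝ] TangentSpace 𝓘(ℝ, E) x

/-- The Nijenhuis expression `[JX, JY] - [X, Y] - J [JX, Y] - J [X, JY]`. -/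
def nijenhuis (J : TangentEndo E M) (X Y : ∀ x : M, TangentSpace 𝓘(ℝ, E) x) (x : M) :
    TangentSpace 𝓘(ℝ, E) x :=
  VectorField.mlieBracket 𝓘(ℝ, E) (fun y => J y (X y)) (fun y => J y (Y y)) x
    - VectorField.mlieBracket 𝓘(ℝ, E) X Y x
    - J x (VectorField.mlieBracket 𝓘(ℝ, E) (fun y => J y (X y)) Y x)
    - J x (VectorField.mlieBracket 𝓘(ℝ, E) X (fun y => J y (Y y)) x)

/-- A complex structure on a smooth manifold: a smooth fibrewise linear map `J : TM → TM` over the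
identity of `M`, with `J² = -1` and with vanishing Nijenhuis expression on smooth vector fields. -/
structure IsComplexStructure [IsManifold 𝓘(ℝ, E) ∞ M] (J : TangentEndo E M) : Prop where
  smooth : ContMDiff 𝓘(ℝ, E).tangent 𝓘(ℝ, E).tangent ∞
    (fun v : TangentBundle 𝓘(ℝ, E) M => (⟨v.1, J v.1 v.2⟩ : TangentBundle 𝓘(ℝ, E) M))
  sq_eq_neg : ∀ (x : M) (v : TangentSpace 𝓘(ℝ, E) x), J x (J x v) = -v
  integrable : ∀ X Y : ∀ x : M, TangentSpace 𝓘(ℝ, E) x,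
    ContMDiff 𝓘(ℝ, E) 𝓘(ℝ, E).tangent ∞ (fun x => (⟨x, X x⟩ : TangentBundle 𝓘(ℝ, E) M)) →
    ContMDiff 𝓘(ℝ, E) 𝓘(ℝ, E).tangent ∞ (fun x => (⟨x, Y x⟩ : TangentBundle 𝓘(ℝ, E) M)) →
    ∀ x : M, nijenhuis J X Y x = 0

/-- A hypercomplex structure on a smooth manifold: three complex structures `I`, `J`, `K`
with `I J = -J I = K`. -/
structure IsHypercomplexStructure [IsManifold 𝓘(ℝ, E) ∞ M] (I J K : TangentEndo E M) : Prop where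
  isComplexStructure_I : IsComplexStructure I
  isComplexStructure_J : IsComplexStructure J
  isComplexStructure_K : IsComplexStructure K
  I_J : ∀ (x : M) (v : TangentSpace 𝓘(ℝ, E) x), I x (J x v) = K x v
  J_I : ∀ (x : M) (v : TangentSpace 𝓘(ℝ, E) x), J x (I x v) = -K x v

/-- `J` commutes with the differentials of all left translations of the group `M`. -/
def IsLeftInvariant [Group M] (J : TangentEndo E M) : Prop :=
  ∀ (g h : M) (v : TangentSpace 𝓘(ℝ, E) h),
    mfderiv 𝓘(ℝ, E) 𝓘(ℝ, E) (fun a : M => g * a) h (J h v)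
      = J (g * h) (mfderiv 𝓘(ℝ, E) 𝓘(ℝ, E) (fun a : M => g * a) h v)

/-- The Lie group `G` admits a left-invariant (homogeneous) hypercomplex structure. -/
def AdmitsHomogeneousHypercomplexStructure
    (E : Type*) [NormedAddCommGroup E] [NormedSpace ℝ E]
    (G : Type*) [TopologicalSpace G] [ChartedSpace E G] [Group G] [LieGroup 𝓘(ℝ, E) ∞ G] : Prop :=
  ∃ I J K : TangentEndo E G, IsHypercomplexStructure I J K ∧
    IsLeftInvariant I ∧ IsLeftInvariant J ∧ IsLeftInvariant K

end Manifolds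

/-! ### The real Lie group underlying `SL(n, ℂ)`

The topology is the one that Mathlib provides (induced from the space of matrices). The charts
are left translates of the following one: near the identity, the equation `det A = 1` can be solved
for the upper left entry of `A`, and the other `n² - 1` entries of `A` serve as coordinates. This is the smooth structure of the embedded submanifold
`det A = 1` of the space of matrices (see `contMDiff_mat` and `contMDiff_of_mat`). -/

namespace SLManifold

open Matrix

section

variable {n : ℕ}

/-- The underlying matrix of an element of `SL(n, ℂ)`. -/
def mat (A : SpecialLinearGroup (Fin n) ℂ) : Matrix (Fin n) (Fin n) ℂ := A.1

/-- A matrix of determinant `1`, as an element of `SL(n, ℂ)`. -/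
def ofMat (A : Matrix (Fin n) (Fin n) ℂ) (hA : A.det = 1) : SpecialLinearGroup (Fin n) ℂ := ⟨A, hA⟩

lemma det_mat (A : SpecialLinearGroup (Fin n) ℂ) : (mat A).det = 1 := A.2

lemma mat_ofMat (A : Matrix (Fin n) (Fin n) ℂ) (hA : A.det = 1) : mat (ofMat A hA) = A := rfl

lemma mat_injective : Function.Injective (mat : SpecialLinearGroup (Fin n) ℂ → _) :=
  Subtype.val_injective

lemma mat_one : mat (1 : SpecialLinearGroup (Fin n) ℂ) = 1 := rfl

lemma mat_mul (A B : SpecialLinearGroup (Fin n) ℂ) : mat (A * B) = mat A * mat B := rfl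

lemma mat_inv (A : SpecialLinearGroup (Fin n) ℂ) : mat A⁻¹ = (mat A).adjugate := rfl

lemma isInducing_mat : Topology.IsInducing (mat : SpecialLinearGroup (Fin n) ℂ → _) :=
  Topology.IsInducing.subtypeVal

end

/-- The model space: all matrix entries but the upper left one. It is used as a real vector space,
of dimension `2 (n² - 1)`. -/
abbrev Coords (n : ℕ) [NeZero n] : Type := {p : Fin n × Fin n // p ≠ (0, 0)} → ℂ

variable {n : ℕ} [NeZero n]

/-- The matrix with upper left entry `t` and with the other entries given by `x`. -/
def fill (x : Coords n) (t : ℂ) : Matrix (Fin n) (Fin n) ℂ :=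
  Matrix.of fun i j => if h : (i, j) ≠ (0, 0) then x ⟨(i, j), h⟩ else t

/-- All entries but the upper left one. -/
def coords (A : Matrix (Fin n) (Fin n) ℂ) : Coords n := fun p => A p.1.1 p.1.2

/-- The cofactor of the upper left entry (see `det_fill`). -/
def cofactor (x : Coords n) : ℂ := (fill x 1).det - (fill x 0).det

lemma fill_eq_updateRow (x : Coords n) (t : ℂ) :
    fill x t = (fill x 0).updateRow 0 (fill x 0 0 + t • Pi.single 0 1) := by
  ext i j
  by_cases hi : i = 0
  · subst hi
    by_cases hj : j = 0
    · subst hj; simp [fill]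
    · simp [fill, hj]
  · simp [fill, hi]

lemma det_fill (x : Coords n) (t : ℂ) : (fill x t).det = cofactor x * t + (fill x 0).det := by
  have key : ∀ s : ℂ, (fill x s).det
      = (fill x 0).det + s * ((fill x 0).updateRow 0 (Pi.single 0 1)).det := by
    intro s
    rw [fill_eq_updateRow, det_updateRow_add, det_updateRow_smul, updateRow_eq_self]
  rw [cofactor, key t, key 1]
  ring

lemma fill_coords (A : Matrix (Fin n) (Fin n) ℂ) : fill (coords A) (A 0 0) = A := by
  ext i j
  by_cases h : (i, j) ≠ (0, 0)
  · simp only [fill, of_apply, dif_pos h, coords]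
  · have h' := not_not.1 h
    simp only [Prod.mk.injEq] at h'
    simp [fill, h'.1, h'.2]

lemma coords_fill (x : Coords n) (t : ℂ) : coords (fill x t) = x := by
  ext p
  simp only [coords, fill, of_apply]
  exact dif_pos p.2

lemma cofactor_coords_one : cofactor (coords (1 : Matrix (Fin n) (Fin n) ℂ)) = 1 := by
  have h1 : (fill (coords (1 : Matrix (Fin n) (Fin n) ℂ)) 1).det = 1 := by
    have := fill_coords (1 : Matrix (Fin n) (Fin n) ℂ)
    rw [one_apply_eq] at this
    rw [this, det_one]
  have h0 : (fill (coords (1 : Matrix (Fin n) (Fin n) ℂ)) 0).det = 0 := by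
    apply det_eq_zero_of_row_eq_zero 0
    intro j
    by_cases hj : j = 0
    · subst hj; simp [fill]
    · simp [fill, coords, hj, one_apply, Ne.symm hj]
  rw [cofactor, h1, h0, sub_zero]

/-- The value of the upper left entry for which the determinant is `1`. -/
def corner (x : Coords n) : ℂ := (1 - (fill x 0).det) / cofactor x

lemma det_fill_corner {x : Coords n} (hx : cofactor x ≠ 0) : (fill x (corner x)).det = 1 := by
  rw [det_fill, corner]
  field_simp
  ring

lemma corner_coords {A : Matrix (Fin n) (Fin n) ℂ} (hA : A.det = 1)
    (h : cofactor (coords A) ≠ 0) : corner (coords A) = A 0 0 := by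
  have := det_fill (coords A) (A 0 0)
  rw [fill_coords, hA] at this
  rw [corner, div_eq_iff h]
  linear_combination this

lemma contDiff_det {n : ℕ} {F : Type*} [NormedAddCommGroup F] [NormedSpace ℝ F]
    {f : F → Matrix (Fin n) (Fin n) ℂ} (hf : ∀ i j, ContDiff ℝ ∞ fun y => f y i j) :
    ContDiff ℝ ∞ fun y => (f y).det := by
  simp only [det_apply']
  exact ContDiff.sum fun σ _ => contDiff_const.mul (contDiff_prod fun i _ => hf _ _)

lemma contDiff_fill_const (t : ℂ) (i j : Fin n) :
    ContDiff ℝ ∞ fun x : Coords n => fill x t i j := by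
  by_cases h : (i, j) ≠ (0, 0)
  · simp only [fill, of_apply, dif_pos h]
    exact contDiff_apply ℝ ℂ _
  · simp only [fill, of_apply, dif_neg h]
    exact contDiff_const

lemma contDiff_cofactor : ContDiff ℝ ∞ (cofactor : Coords n → ℂ) :=
  (contDiff_det (contDiff_fill_const 1)).sub (contDiff_det (contDiff_fill_const 0))

lemma isOpen_cofactor_ne_zero : IsOpen {x : Coords n | cofactor x ≠ 0} :=
  isOpen_ne_fun contDiff_cofactor.continuous continuous_const

lemma contDiffOn_fill_corner (i j : Fin n) :
    ContDiffOn ℝ ∞ (fun x : Coords n => fill x (corner x) i j) {x | cofactor x ≠ 0} := by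
  by_cases h : (i, j) ≠ (0, 0)
  · simp only [fill, of_apply, dif_pos h]
    exact (contDiff_apply ℝ ℂ _).contDiffOn
  · simp only [fill, of_apply, dif_neg h, corner]
    simp only [div_eq_mul_inv]
    exact ((contDiff_const.sub (contDiff_det (contDiff_fill_const 0))).contDiffOn).mul
      (contDiff_cofactor.contDiffOn.fun_inv fun x hx => hx)

lemma continuous_coords :
    Continuous fun A : SpecialLinearGroup (Fin n) ℂ => coords (mat A) :=
  continuous_pi fun p => isInducing_mat.continuous.matrix_elem p.1.1 p.1.2

/-- The matrix with coordinates `x` and determinant `1` (the value is irrelevant if the cofactor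
of `x` vanishes). -/
def ofCoords (x : Coords n) : SpecialLinearGroup (Fin n) ℂ :=
  if h : cofactor x ≠ 0 then ofMat (fill x (corner x)) (det_fill_corner h) else 1

lemma mat_ofCoords {x : Coords n} (hx : cofactor x ≠ 0) :
    mat (ofCoords x) = fill x (corner x) := by
  rw [ofCoords, dif_pos hx, mat_ofMat]

/-- The chart around the identity. -/
def baseChart (n : ℕ) [NeZero n] :
    OpenPartialHomeomorph (SpecialLinearGroup (Fin n) ℂ) (Coords n) where
  toFun A := coords (mat A)
  invFun x := ofCoords x
  source := {A | cofactor (coords (mat A)) ≠ 0}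
  target := {x | cofactor x ≠ 0}
  map_source' A hA := hA
  map_target' x hx := by
    have hx' : cofactor x ≠ 0 := hx
    change cofactor (coords (mat (ofCoords x))) ≠ 0
    rwa [mat_ofCoords hx', coords_fill]
  left_inv' A hA := by
    have hA' : cofactor (coords (mat A)) ≠ 0 := hA
    apply mat_injective
    rw [mat_ofCoords hA', corner_coords (det_mat A) hA', fill_coords]
  right_inv' x hx := by
    have hx' : cofactor x ≠ 0 := hx
    rw [mat_ofCoords hx', coords_fill]
  open_source := isOpen_cofactor_ne_zero.preimage continuous_coords
  open_target := isOpen_cofactor_ne_zero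
  continuousOn_toFun := continuous_coords.continuousOn
  continuousOn_invFun := by
    rw [isInducing_mat.continuousOn_iff]
    have : ContinuousOn (fun x : Coords n => fill x (corner x)) {x | cofactor x ≠ 0} :=
      continuousOn_pi.2 fun i => continuousOn_pi.2 fun j =>
        (contDiffOn_fill_corner i j).continuousOn
    exact this.congr fun x hx => mat_ofCoords hx

/-- The chart around `g`: the chart around the identity, left translated by `g`. -/
def chart (g : SpecialLinearGroup (Fin n) ℂ) :
    OpenPartialHomeomorph (SpecialLinearGroup (Fin n) ℂ) (Coords n) :=
  (Homeomorph.mulLeft g⁻¹).toOpenPartialHomeomorph.trans (baseChart n)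

lemma mem_chart_source_self (g : SpecialLinearGroup (Fin n) ℂ) : g ∈ (chart g).source := by
  rw [chart, OpenPartialHomeomorph.trans_source]
  refine ⟨trivial, ?_⟩
  change cofactor (coords (mat (g⁻¹ * g))) ≠ 0
  rw [inv_mul_cancel, mat_one, cofactor_coords_one]
  exact one_ne_zero

instance instChartedSpace : ChartedSpace (Coords n) (SpecialLinearGroup (Fin n) ℂ) where
  atlas := Set.range chart
  chartAt := chart
  mem_chart_source := mem_chart_source_self
  chart_mem_atlas g := ⟨g, rfl⟩

lemma chart_apply (g A : SpecialLinearGroup (Fin n) ℂ) : chart g A = coords (mat (g⁻¹ * A)) :=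
  rfl

lemma chart_target (g : SpecialLinearGroup (Fin n) ℂ) :
    (chart g).target = {x | cofactor x ≠ 0} := by
  simp [chart, baseChart]

lemma mat_chart_symm (g : SpecialLinearGroup (Fin n) ℂ) {x : Coords n} (hx : cofactor x ≠ 0) :
    mat ((chart g).symm x) = mat g * fill x (corner x) := by
  have h : (chart g).symm x = g⁻¹⁻¹ * ofCoords x := rfl
  rw [h, inv_inv, mat_mul, mat_ofCoords hx]

lemma contDiffOn_mat_chart_symm (g : SpecialLinearGroup (Fin n) ℂ) (i j : Fin n) :
    ContDiffOn ℝ ∞ (fun x => mat ((chart g).symm x) i j) (chart g).target := by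
  rw [chart_target]
  have : ContDiffOn ℝ ∞ (fun x : Coords n => ∑ k, mat g i k * fill x (corner x) k j)
      {x | cofactor x ≠ 0} :=
    ContDiffOn.sum fun k _ => contDiffOn_const.mul (contDiffOn_fill_corner k j)
  refine this.congr fun x hx => ?_
  rw [mat_chart_symm g hx, mul_apply]

instance instIsManifold : IsManifold 𝓘(ℝ, Coords n) ∞ (SpecialLinearGroup (Fin n) ℂ) := by
  apply isManifold_of_contDiffOn
  rintro _ _ ⟨g, rfl⟩ ⟨h, rfl⟩
  simp only [modelWithCornersSelf_coe, modelWithCornersSelf_coe_symm, Function.comp_id,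
    Function.id_comp, Set.range_id, Set.inter_univ, Set.preimage_id]
  rw [contDiffOn_pi]
  intro p
  have : ContDiffOn ℝ ∞ (fun x : Coords n => ∑ k, mat h⁻¹ p.1.1 k
      * mat ((chart g).symm x) k p.1.2) (chart g).target :=
    ContDiffOn.sum fun k _ => contDiffOn_const.mul (contDiffOn_mat_chart_symm g k _)
  refine (this.mono fun x hx => hx.1).congr fun x _ => ?_
  change chart h ((chart g).symm x) p = _
  rw [chart_apply, coords, mat_mul, mul_apply]

lemma contMDiffRing_complex : ContMDiffRing 𝓘(ℝ, ℂ) ∞ ℂ where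
  contMDiff_add := contMDiff_add 𝓘(ℝ, ℂ) ∞
  contMDiff_mul := by
    have h : ContMDiff (𝓘(ℝ, ℂ).prod 𝓘(ℝ, ℂ)) 𝓘(ℝ, ℂ) ∞
        fun p : ℂ × ℂ => ContinuousLinearMap.mul ℝ ℂ p.1 p.2 :=
      (contMDiff_const (c := ContinuousLinearMap.mul ℝ ℂ)).clm_apply contMDiff_fst
        |>.clm_apply contMDiff_snd
    exact h

/-- The matrix entries are smooth functions on `SL(n, ℂ)`. -/
lemma contMDiff_mat (i j : Fin n) :
    ContMDiff 𝓘(ℝ, Coords n) 𝓘(ℝ, ℂ) ∞ fun A : SpecialLinearGroup (Fin n) ℂ => mat A i j := by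
  intro g
  have h1 : ContMDiffOn 𝓘(ℝ, Coords n) 𝓘(ℝ, ℂ) ∞
      (fun x => mat ((chart g).symm x) i j) (chart g).target :=
    (contDiffOn_mat_chart_symm g i j).contMDiffOn
  have h2 : ContMDiffOn 𝓘(ℝ, Coords n) 𝓘(ℝ, Coords n) ∞ (chart g) (chart g).source :=
    contMDiffOn_chart (x := g)
  have h3 := h1.comp h2 fun A hA => (chart g).map_source hA
  refine (h3.congr fun A hA => ?_).contMDiffAt
    ((chart g).open_source.mem_nhds (mem_chart_source_self g))
  simp only [Function.comp_apply, (chart g).left_inv hA]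

/-- A map into `SL(n, ℂ)` is smooth if its matrix entries are. -/
lemma contMDiff_of_mat {F H N : Type*} [NormedAddCommGroup F] [NormedSpace ℝ F]
    [TopologicalSpace H] {J : ModelWithCorners ℝ F H} [TopologicalSpace N] [ChartedSpace H N]
    {f : N → SpecialLinearGroup (Fin n) ℂ}
    (hf : ∀ i j, ContMDiff J 𝓘(ℝ, ℂ) ∞ fun y => mat (f y) i j) :
    ContMDiff J 𝓘(ℝ, Coords n) ∞ f := by
  have := contMDiffRing_complex
  intro y
  rw [contMDiffAt_iff_target]
  refine ⟨?_, ?_⟩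
  · refine Continuous.continuousAt (isInducing_mat.continuous_iff.2 ?_)
    exact continuous_pi fun i => continuous_pi fun j => (hf i j).continuous
  · rw [contMDiffAt_pi_space]
    intro p
    have : ContMDiff J 𝓘(ℝ, ℂ) ∞ fun z => ∑ k, mat (f y)⁻¹ p.1.1 k * mat (f z) k p.1.2 :=
      contMDiff_finsetSum fun k _ => contMDiff_const.mul (hf k _)
    refine (this y).congr_of_eventuallyEq (Filter.Eventually.of_forall fun z => ?_)
    change chart (f y) (f z) p = _
    rw [chart_apply, coords, mat_mul, mul_apply]

instance instLieGroup : LieGroup 𝓘(ℝ, Coords n) ∞ (SpecialLinearGroup (Fin n) ℂ) where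
  contMDiff_mul := by
    have := contMDiffRing_complex
    refine contMDiff_of_mat fun i j => ?_
    simp only [mat_mul, mul_apply]
    exact contMDiff_finsetSum fun k _ =>
      ((contMDiff_mat i k).comp contMDiff_fst).mul ((contMDiff_mat k j).comp contMDiff_snd)
  contMDiff_inv := by
    have := contMDiffRing_complex
    refine contMDiff_of_mat fun i j => ?_
    simp only [mat_inv, adjugate_apply, det_apply']
    refine contMDiff_finsetSum fun σ _ => contMDiff_const.mul (contMDiff_finsetProd fun k _ => ?_)
    by_cases h : σ k = j
    · simp only [updateRow_apply, h, if_true]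
      exact contMDiff_const
    · simp only [updateRow_apply, h, if_false]
      exact contMDiff_mat _ _

end SLManifold

end

/-! Everything reduces to linear algebra on the Lie algebra. A left-invariant endomorphism field is
determined by its value at the identity, and the Nijenhuis expression is tensorial once `J² = -1`
(`nijenhuis_congr`), so it may be tested on left-invariant fields. There it becomes an identity for
the Lie bracket (`isComplexStructure_leftInvariantEndo`). The Lie algebra of `SL(n, ℂ)` is the space
of traceless matrices with the commutator (`dMat_lie`, `dMat_coords`).

For `n = 2m - 1`, cut matrices into `m - 1` diagonal blocks of size 2 and a last block of size 1 at
the index `z`. Let `Q` be block diagonal, with square `-1` on the blocks of size 2 and zero at `z`.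
The operator `T X = Q U - L Q`, with `U` the block upper triangular part of `X` and `L` the rest,
satisfies `T² = -1` on the matrices whose entry at `z` vanishes (`twistedMul_sq`). These matrices
represent all matrices modulo scalars, and so do the traceless ones; this carries `T` over to `sl(n,
ℂ)`.

Integrability: `T` is complex linear, so it suffices that its eigenspaces for `i` and `-i` are
closed under the commutator. They are even closed under matrix multiplication
(`IsBlockDiag.twistedMul_mul`).

Quaternion relations: if `Q Q' = -Q' Q`, the operators of `Q` and `Q'` compose to that of `Q Q'`
(`twistedMul_twistedMul`). Copies of two anticommuting quaternion units in the blocks of size 2 give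
such a pair. -/

open scoped Manifold ContDiff

noncomputable section

namespace BlockComplexStructure

open Matrix

/-! ### Block triangular parts and twisted multiplication. -/

section Parts

variable {ι : Type*} (b : ι → ℕ)

/-- The block upper triangular part of a matrix. -/
def upper : Matrix ι ι ℂ →ₗ[ℂ] Matrix ι ι ℂ where
  toFun X := of fun i j => if b i ≤ b j then X i j else 0
  map_add' X Y := by ext i j; by_cases h : b i ≤ b j <;> simp [h]
  map_smul' c X := by ext i j; by_cases h : b i ≤ b j <;> simp [h]

/-- The strictly block lower triangular part of a matrix. -/
def lower : Matrix ι ι ℂ →ₗ[ℂ] Matrix ι ι ℂ := LinearMap.id - upper b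

lemma upper_apply (X : Matrix ι ι ℂ) (i j : ι) :
    upper b X i j = if b i ≤ b j then X i j else 0 := rfl

lemma lower_apply (X : Matrix ι ι ℂ) (i j : ι) :
    lower b X i j = if b i ≤ b j then 0 else X i j := by
  by_cases h : b i ≤ b j <;> simp [lower, upper_apply, h]

lemma upper_add_lower (X : Matrix ι ι ℂ) : upper b X + lower b X = X := by
  simp [lower]

lemma upper_upper (X : Matrix ι ι ℂ) : upper b (upper b X) = upper b X := by
  ext i j; by_cases h : b i ≤ b j <;> simp [upper_apply, h]

lemma lower_lower (X : Matrix ι ι ℂ) : lower b (lower b X) = lower b X := by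
  ext i j; by_cases h : b i ≤ b j <;> simp [lower_apply, h]

lemma upper_lower (X : Matrix ι ι ℂ) : upper b (lower b X) = 0 := by
  simp [lower, upper_upper]

lemma lower_upper (X : Matrix ι ι ℂ) : lower b (upper b X) = 0 := by
  simp [lower, upper_upper]

variable [Fintype ι]

lemma lower_upper_mul_upper (X Y : Matrix ι ι ℂ) : lower b (upper b X * upper b Y) = 0 := by
  ext i j
  rw [lower_apply, mul_apply, Matrix.zero_apply]
  split_ifs with h
  · rfl
  · refine Finset.sum_eq_zero fun k _ => ?_
    rw [upper_apply, upper_apply]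
    split_ifs with h1 h2
    · exact absurd (h1.trans h2) h
    all_goals simp

lemma upper_lower_mul_lower (X Y : Matrix ι ι ℂ) : upper b (lower b X * lower b Y) = 0 := by
  ext i j
  rw [upper_apply, mul_apply, Matrix.zero_apply]
  split_ifs with h
  · refine Finset.sum_eq_zero fun k _ => ?_
    rw [lower_apply, lower_apply]
    split_ifs with h1 h2 h2
    · simp
    · simp
    · simp
    · omega
  · rfl

/-- A matrix all of whose nonzero entries are in diagonal blocks. -/
def IsBlockDiag (Q : Matrix ι ι ℂ) : Prop := ∀ i j, b i ≠ b j → Q i j = 0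

variable {b} {Q Q' : Matrix ι ι ℂ}

/-- A block diagonal factor only mixes rows (on the right: columns) of the same block, so it never
moves an entry across the block diagonal. -/
lemma IsBlockDiag.upper_mul (hQ : IsBlockDiag b Q) (X : Matrix ι ι ℂ) :
    upper b (Q * X) = Q * upper b X := by
  ext i j
  have h : ∀ k, Q i k * upper b X k j = if b i ≤ b j then Q i k * X k j else 0 := by
    intro k
    by_cases hk : b i = b k
    · rw [upper_apply, hk, mul_ite, mul_zero]
    · simp [hQ i k hk]
  rw [upper_apply, mul_apply, mul_apply, Finset.sum_congr rfl fun k _ => h k]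
  split_ifs <;> simp

lemma IsBlockDiag.lower_mul (hQ : IsBlockDiag b Q) (X : Matrix ι ι ℂ) :
    lower b (Q * X) = Q * lower b X := by
  simp [lower, hQ.upper_mul, Matrix.mul_sub]

lemma IsBlockDiag.upper_mul_right (hQ : IsBlockDiag b Q) (X : Matrix ι ι ℂ) :
    upper b (X * Q) = upper b X * Q := by
  ext i j
  have h : ∀ k, upper b X i k * Q k j = if b i ≤ b j then X i k * Q k j else 0 := by
    intro k
    by_cases hk : b k = b j
    · rw [upper_apply, hk, ite_mul, zero_mul]
    · simp [hQ k j hk]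
  rw [upper_apply, mul_apply, mul_apply, Finset.sum_congr rfl fun k _ => h k]
  split_ifs <;> simp

lemma IsBlockDiag.lower_mul_right (hQ : IsBlockDiag b Q) (X : Matrix ι ι ℂ) :
    lower b (X * Q) = lower b X * Q := by
  simp [lower, hQ.upper_mul_right, Matrix.sub_mul]

lemma IsBlockDiag.mul (hQ : IsBlockDiag b Q) (hQ' : IsBlockDiag b Q') :
    IsBlockDiag b (Q * Q') := by
  intro i j h
  refine Finset.sum_eq_zero fun k _ => ?_
  by_cases hk : b i = b k
  · exact mul_eq_zero_of_right _ (hQ' k j (hk ▸ h))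
  · exact mul_eq_zero_of_left (hQ i k hk) _

variable (b) in
/-- Left multiplication by `Q` on the block upper triangular part, and right multiplication by `-Q`
on the strictly block lower triangular part. -/
def twistedMul (Q : Matrix ι ι ℂ) : Matrix ι ι ℂ →ₗ[ℂ] Matrix ι ι ℂ :=
  LinearMap.mulLeft ℂ Q ∘ₗ upper b - LinearMap.mulRight ℂ Q ∘ₗ lower b

lemma twistedMul_apply (X : Matrix ι ι ℂ) :
    twistedMul b Q X = Q * upper b X - lower b X * Q := rfl

/-- Right multiplication reverses the order of the factors. For anticommuting `Q` and `Q'` the minus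
sign in `twistedMul` compensates for this, and the right-hand side is `twistedMul b (Q * Q') X`. -/
lemma twistedMul_twistedMul (hQ' : IsBlockDiag b Q')
    (X : Matrix ι ι ℂ) :
    twistedMul b Q (twistedMul b Q' X) = Q * Q' * upper b X + lower b X * (Q' * Q) := by
  simp only [twistedMul_apply, map_sub, hQ'.upper_mul, hQ'.lower_mul, hQ'.upper_mul_right,
    hQ'.lower_mul_right, upper_upper, lower_lower, upper_lower, lower_upper]
  simp [Matrix.mul_assoc]

/-- The eigenspaces of a twisted multiplication for nonzero eigenvalues are closed under
multiplication. -/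
lemma IsBlockDiag.twistedMul_mul (hQ : IsBlockDiag b Q) {c : ℂ} (hc : c ≠ 0)
    {X Y : Matrix ι ι ℂ} (hX : twistedMul b Q X = c • X) (hY : twistedMul b Q Y = c • Y) :
    twistedMul b Q (X * Y) = c • (X * Y) := by
  have key : ∀ Z : Matrix ι ι ℂ, twistedMul b Q Z = c • Z →
      Q * upper b Z = c • upper b Z ∧ lower b Z * Q = -(c • lower b Z) := by
    intro Z hZ
    have h1 := congrArg (upper b) hZ
    have h2 := congrArg (lower b) hZ
    simp only [twistedMul_apply, map_sub, map_smul, hQ.upper_mul, hQ.lower_mul,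
      hQ.upper_mul_right, hQ.lower_mul_right, upper_upper, lower_lower, upper_lower, lower_upper,
      Matrix.mul_zero, Matrix.zero_mul, sub_zero, zero_sub] at h1 h2
    exact ⟨h1, neg_eq_iff_eq_neg.1 h2⟩
  obtain ⟨hXU, hXL⟩ := key X hX
  obtain ⟨hYU, hYL⟩ := key Y hY
  -- Evaluating `lower b X * Q * upper b Y` in two ways yields both `-c` and `c` times the product.
  -- This kills the only term of `X * Y` on which `Q` acts in neither of the required ways.
  have h0 : lower b X * upper b Y = 0 := by
    have h : -(c • lower b X) * upper b Y = lower b X * (c • upper b Y) := by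
      rw [← hXL, ← hYU, Matrix.mul_assoc]
    rw [Matrix.neg_mul, Matrix.smul_mul, Matrix.mul_smul, neg_eq_iff_add_eq_zero, ← two_smul ℂ, smul_smul] at h
    exact (smul_eq_zero.1 h).resolve_left (mul_ne_zero two_ne_zero hc)
  have hXY : X * Y = upper b X * upper b Y + upper b X * lower b Y + lower b X * lower b Y := by
    conv_lhs => rw [← upper_add_lower b X, ← upper_add_lower b Y]
    rw [Matrix.add_mul, Matrix.mul_add, Matrix.mul_add, h0, zero_add]
  have h1 : Q * upper b (X * Y) = c • upper b (X * Y) := by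
    rw [hXY, map_add, upper_lower_mul_lower, add_zero, ← hQ.upper_mul, Matrix.mul_add,
      ← Matrix.mul_assoc, ← Matrix.mul_assoc, hXU, Matrix.smul_mul, Matrix.smul_mul, ← smul_add, map_smul]
  have h2 : lower b (X * Y) * Q = -(c • lower b (X * Y)) := by
    rw [hXY, add_assoc, map_add, lower_upper_mul_upper, zero_add, ← hQ.lower_mul_right,
      Matrix.add_mul, Matrix.mul_assoc, Matrix.mul_assoc, hYL, Matrix.mul_neg, Matrix.mul_neg,
      Matrix.mul_smul, Matrix.mul_smul, ← neg_add, ← smul_add, map_neg, map_smul]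
  rw [twistedMul_apply, h1, h2, sub_neg_eq_add, ← smul_add, upper_add_lower]

end Parts

/-! ### Complex structures on traceless matrices from admissible matrices. -/

/-- `Q` is block diagonal and is a complex structure on all blocks but the last one, which is the
singleton `z` and on which `Q` vanishes. -/
structure IsAdmissible {ι : Type*} [Fintype ι] [DecidableEq ι] (b : ι → ℕ) (z : ι)
    (Q : Matrix ι ι ℂ) : Prop where
  isBlockDiag : IsBlockDiag b Q
  last : ∀ j, b z ≤ b j → j = z
  row : ∀ j, Q z j = 0
  col : ∀ j, Q j z = 0
  sq : Q * Q = single z z 1 - 1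

section Traceless

variable {ι : Type*} [DecidableEq ι]

/-- The multiple of the identity that differs from `X` by a matrix whose entry at `z` vanishes is
subtracted. -/
def normalize (z : ι) : Matrix ι ι ℂ →ₗ[ℂ] Matrix ι ι ℂ where
  toFun X := X - X z z • 1
  map_add' X Y := by rw [Matrix.add_apply, add_smul]; abel
  map_smul' c X := by rw [Matrix.smul_apply, smul_assoc, RingHom.id_apply, smul_sub]

lemma normalize_apply (z : ι) (X : Matrix ι ι ℂ) : normalize z X = X - X z z • 1 := rfl

lemma normalize_apply_self (z : ι) (X : Matrix ι ι ℂ) : normalize z X z z = 0 := by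
  simp [normalize_apply]

variable [Fintype ι]

/-- The traceless part of a matrix. -/
def traceless : Matrix ι ι ℂ →ₗ[ℂ] Matrix ι ι ℂ where
  toFun X := X - ((Fintype.card ι : ℂ)⁻¹ * X.trace) • 1
  map_add' X Y := by rw [trace_add, mul_add, add_smul]; abel
  map_smul' c X := by
    rw [trace_smul, RingHom.id_apply, smul_sub, smul_smul, smul_eq_mul, mul_left_comm]

variable {b : ι → ℕ} {z : ι} {Q Q' : Matrix ι ι ℂ} {X Y : Matrix ι ι ℂ}

lemma traceless_apply : traceless X = X - ((Fintype.card ι : ℂ)⁻¹ * X.trace) • 1 := rfl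

lemma trace_traceless [Nonempty ι] : (traceless X).trace = 0 := by
  rw [traceless_apply, trace_sub, trace_smul, trace_one, smul_eq_mul]
  field_simp
  ring

lemma traceless_of_trace_eq_zero (hX : X.trace = 0) : traceless X = X := by
  simp [traceless_apply, hX]

/-- `traceless` and `normalize z` pick different representatives modulo scalar matrices, hence are
mutually inverse between the two spaces of representatives. -/
lemma normalize_traceless (hX : X z z = 0) : normalize z (traceless X) = X := by
  simp [normalize_apply, traceless_apply, hX]

lemma traceless_normalize [Nonempty ι] (hX : X.trace = 0) : traceless (normalize z X) = X := by
  rw [normalize_apply, map_sub, traceless_of_trace_eq_zero hX, map_smul, traceless_apply, trace_one,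
    inv_mul_cancel₀ (by simp), one_smul, sub_self, smul_zero, sub_zero]

lemma commutator_sub_smul_one (X Y : Matrix ι ι ℂ) (c d : ℂ) :
    (X - c • 1) * (Y - d • 1) - (Y - d • 1) * (X - c • 1) = X * Y - Y * X := by
  simp only [Matrix.sub_mul, Matrix.mul_sub, Matrix.smul_mul, Matrix.mul_smul, Matrix.one_mul,
    Matrix.mul_one, smul_sub]
  rw [smul_comm c d]
  abel

lemma commutator_traceless_left (X Y : Matrix ι ι ℂ) :
    traceless X * Y - Y * traceless X = X * Y - Y * X := by
  simpa [traceless_apply] using commutator_sub_smul_one X Y ((Fintype.card ι : ℂ)⁻¹ * X.trace) 0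

lemma commutator_traceless_right (X Y : Matrix ι ι ℂ) :
    X * traceless Y - traceless Y * X = X * Y - Y * X := by
  simpa [traceless_apply] using commutator_sub_smul_one X Y 0 ((Fintype.card ι : ℂ)⁻¹ * Y.trace)

lemma commutator_normalize_left (X Y : Matrix ι ι ℂ) :
    normalize z X * Y - Y * normalize z X = X * Y - Y * X := by
  simpa [normalize_apply] using commutator_sub_smul_one X Y (X z z) 0

lemma commutator_normalize_right (X Y : Matrix ι ι ℂ) :
    X * normalize z Y - normalize z Y * X = X * Y - Y * X := by
  simpa [normalize_apply] using commutator_sub_smul_one X Y 0 (Y z z)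

namespace IsAdmissible

lemma twistedMul_apply_self (hQ : IsAdmissible b z Q) : twistedMul b Q X z z = 0 := by
  rw [twistedMul_apply, Matrix.sub_apply, mul_apply, mul_apply]
  simp [hQ.row, hQ.col]

/-- The defect `single z z 1` in `Q * Q` does no harm because the block of `z` is the last one: row
`z` of the upper part has at most the entry at `z`, which is zero, and column `z` of the lower part
is empty. -/
lemma twistedMul_sq (hQ : IsAdmissible b z Q) (hX : X z z = 0) :
    twistedMul b Q (twistedMul b Q X) = -X := by
  rw [twistedMul_twistedMul hQ.isBlockDiag, hQ.sq]
  have h1 : single z z 1 * upper b X = 0 := by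
    ext i j
    rw [mul_apply]
    refine Finset.sum_eq_zero fun k _ => ?_
    rw [single_apply, upper_apply]
    split_ifs with h h'
    · rw [← h.2] at h' ⊢
      rw [hQ.last j h', hX, mul_zero]
    all_goals simp
  have h2 : lower b X * single z z 1 = 0 := by
    ext i j
    rw [mul_apply]
    refine Finset.sum_eq_zero fun k _ => ?_
    rw [single_apply, lower_apply]
    split_ifs with h h' h'
    · simp
    · simp
    · rw [← h'.1] at h
      exact absurd (congrArg b (hQ.last i (not_le.1 h).le)).le h
    · simp
  rw [Matrix.sub_mul, Matrix.mul_sub, h1, h2, Matrix.one_mul, Matrix.mul_one, zero_sub, zero_sub,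
    ← neg_add, upper_add_lower]

/-- Values of `twistedMul b Q` vanish at `z`, hence so do its eigenvectors for `c ≠ 0`. The
commutator is such an eigenvector, and normalizing it changes nothing. -/
lemma twistedMul_commutator (hQ : IsAdmissible b z Q) {c : ℂ} (hc : c ≠ 0)
    (hX : twistedMul b Q X = c • X) (hY : twistedMul b Q Y = c • Y) :
    twistedMul b Q (normalize z (X * Y - Y * X)) = c • (X * Y - Y * X) := by
  have h : twistedMul b Q (X * Y - Y * X) = c • (X * Y - Y * X) := by
    rw [map_sub, hQ.isBlockDiag.twistedMul_mul hc hX hY, hQ.isBlockDiag.twistedMul_mul hc hY hX,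
      smul_sub]
  have h0 : (X * Y - Y * X) z z = 0 := by
    have h1 := hQ.twistedMul_apply_self (X := X * Y - Y * X)
    rw [h, Matrix.smul_apply, smul_eq_mul] at h1
    exact (mul_eq_zero.1 h1).resolve_left hc
  rw [normalize_apply, h0, zero_smul, sub_zero, h]

/-- The Nijenhuis expression of a twisted multiplication vanishes on matrices whose entry at `z`
vanishes, for the commutator bracket modulo multiples of the identity. -/
lemma twistedMul_integrable (hQ : IsAdmissible b z Q) (hX : X z z = 0) (hY : Y z z = 0) :
    (twistedMul b Q X * twistedMul b Q Y - twistedMul b Q Y * twistedMul b Q X)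
      - (X * Y - Y * X)
      - twistedMul b Q (normalize z (twistedMul b Q X * Y - Y * twistedMul b Q X))
      - twistedMul b Q (normalize z (X * twistedMul b Q Y - twistedMul b Q Y * X)) = 0 := by
  set T := twistedMul b Q with hT
  -- Since `T` is complex linear, its eigenspaces lie in the matrix space itself and no
  -- complexification is needed.
  have hdec : ∀ Z : Matrix ι ι ℂ, Z z z = 0 → ∃ P N : Matrix ι ι ℂ, Z = P + N ∧
      T P = Complex.I • P ∧ T N = -(Complex.I • N) := by
    intro Z hZ
    have hs : T (T Z) = -Z := hQ.twistedMul_sq hZ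
    refine ⟨(2⁻¹ : ℂ) • (Z - Complex.I • T Z), (2⁻¹ : ℂ) • (Z + Complex.I • T Z), ?_, ?_, ?_⟩
    · rw [← smul_add, sub_add_add_cancel, ← two_smul ℂ, smul_smul]
      norm_num
    · simp only [map_smul, map_sub, hs, smul_sub, smul_smul, smul_neg]
      rw [mul_left_comm, Complex.I_mul_I]
      module
    · simp only [map_smul, map_add, hs, smul_add, smul_smul, smul_neg]
      rw [mul_left_comm, Complex.I_mul_I]
      module
  obtain ⟨P, N, rfl, hP, hN⟩ := hdec X hX
  obtain ⟨P', N', rfl, hP', hN'⟩ := hdec Y hY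
  have hPP := hQ.twistedMul_commutator Complex.I_ne_zero hP hP'
  have hNN := hQ.twistedMul_commutator (neg_ne_zero.2 Complex.I_ne_zero)
    (hN.trans (neg_smul _ _).symm) (hN'.trans (neg_smul _ _).symm)
  have e1 : T (P + N) = Complex.I • P - Complex.I • N := by rw [map_add, hP, hN, sub_eq_add_neg]
  have e2 : T (P' + N') = Complex.I • P' - Complex.I • N' := by
    rw [map_add, hP', hN', sub_eq_add_neg]
  have h0 : (P + N) * (P' + N') - (P' + N') * (P + N)
      = (P * P' - P' * P) + (P * N' - N' * P) + (N * P' - P' * N) + (N * N' - N' * N) := by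
    simp only [Matrix.mul_add, Matrix.add_mul]
    abel
  have h1 : T (P + N) * (P' + N') - (P' + N') * T (P + N)
      = Complex.I • (P * P' - P' * P) + Complex.I • (P * N' - N' * P)
        - Complex.I • (N * P' - P' * N) - Complex.I • (N * N' - N' * N) := by
    simp only [e1, Matrix.mul_add, Matrix.add_mul, Matrix.mul_sub, Matrix.sub_mul, Matrix.smul_mul,
      Matrix.mul_smul]
    module
  have h2 : (P + N) * T (P' + N') - T (P' + N') * (P + N)
      = Complex.I • (P * P' - P' * P) - Complex.I • (P * N' - N' * P)
        + Complex.I • (N * P' - P' * N) - Complex.I • (N * N' - N' * N) := by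
    simp only [e2, Matrix.mul_add, Matrix.add_mul, Matrix.mul_sub, Matrix.sub_mul, Matrix.smul_mul,
      Matrix.mul_smul]
    module
  have h3 : T (P + N) * T (P' + N') - T (P' + N') * T (P + N)
      = -(P * P' - P' * P) + (P * N' - N' * P) + (N * P' - P' * N) - (N * N' - N' * N) := by
    simp only [e1, e2, Matrix.mul_sub, Matrix.sub_mul, Matrix.smul_mul, Matrix.mul_smul, smul_sub,
      smul_smul, Complex.I_mul_I]
    module
  rw [h0, h1, h2, h3]
  -- The mixed commutators `B` and `C` cancel without any information on `T B` and `T C`; only `A`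
  -- and `D` use that the eigenspaces are closed.
  generalize P * P' - P' * P = A at *
  generalize P * N' - N' * P = B at *
  generalize N * P' - P' * N = C at *
  generalize N * N' - N' * N = D at *
  have hS : ∀ Z, twistedMul b Q (normalize z Z) = (T ∘ₗ normalize z) Z := fun _ => rfl
  rw [hS] at hPP hNN
  rw [← LinearMap.comp_apply, ← LinearMap.comp_apply]
  simp only [map_add, map_sub, map_smul, hPP, hNN, smul_smul, mul_neg, Complex.I_mul_I]
  module

end IsAdmissible

variable (b z Q) in
/-- The endomorphism of traceless matrices that corresponds to the twisted multiplication by `Q` on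
matrices whose entry at `z` vanishes. -/
def complexStructure : Matrix ι ι ℂ →ₗ[ℂ] Matrix ι ι ℂ :=
  traceless ∘ₗ twistedMul b Q ∘ₗ normalize z

lemma complexStructure_apply (X : Matrix ι ι ℂ) :
    complexStructure b z Q X = traceless (twistedMul b Q (normalize z X)) := rfl

lemma trace_complexStructure [Nonempty ι] (X : Matrix ι ι ℂ) :
    (complexStructure b z Q X).trace = 0 := trace_traceless

namespace IsAdmissible

lemma complexStructure_comp (hQ' : IsAdmissible b z Q') (Q : Matrix ι ι ℂ) (X : Matrix ι ι ℂ) :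
    complexStructure b z Q (complexStructure b z Q' X)
      = traceless (twistedMul b Q (twistedMul b Q' (normalize z X))) := by
  rw [complexStructure_apply, complexStructure_apply, normalize_traceless hQ'.twistedMul_apply_self]

lemma complexStructure_sq [Nonempty ι] (hQ : IsAdmissible b z Q) (hX : X.trace = 0) :
    complexStructure b z Q (complexStructure b z Q X) = -X := by
  rw [hQ.complexStructure_comp, hQ.twistedMul_sq (normalize_apply_self z X), map_neg,
    traceless_normalize hX]

lemma complexStructure_mul (hQ' : IsAdmissible b z Q') (h : Q * Q' = -(Q' * Q)) :
    complexStructure b z Q (complexStructure b z Q' X) = complexStructure b z (Q * Q') X := by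
  rw [hQ'.complexStructure_comp, twistedMul_twistedMul hQ'.isBlockDiag, complexStructure_apply,
    twistedMul_apply, h, Matrix.mul_neg, sub_neg_eq_add]

lemma complexStructure_mul_swap (hQ : IsAdmissible b z Q) (h : Q * Q' = -(Q' * Q)) :
    complexStructure b z Q' (complexStructure b z Q X) = -complexStructure b z (Q * Q') X := by
  rw [hQ.complexStructure_comp, twistedMul_twistedMul hQ.isBlockDiag, complexStructure_apply,
    ← map_neg, twistedMul_apply, h, Matrix.neg_mul, Matrix.mul_neg]
  congr 1
  abel

/-- Commutators ignore scalar matrices and are already traceless, so `twistedMul_integrable` carries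
over to the traceless representatives. -/
lemma complexStructure_integrable (hQ : IsAdmissible b z Q) (X Y : Matrix ι ι ℂ) :
    let J := complexStructure b z Q
    (J X * J Y - J Y * J X) - (X * Y - Y * X) - J (J X * Y - Y * J X) - J (X * J Y - J Y * X)
      = 0 := by
  have h := congrArg traceless
    (hQ.twistedMul_integrable (normalize_apply_self z X) (normalize_apply_self z Y))
  have ht : ∀ A B : Matrix ι ι ℂ, traceless (A * B - B * A) = A * B - B * A := fun A B =>
    traceless_of_trace_eq_zero (by rw [trace_sub, trace_mul_comm, sub_self])
  simp only [map_sub traceless _ (twistedMul b Q _), map_sub traceless (_ - _ : Matrix ι ι ℂ)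
    (_ * _ - _ : Matrix ι ι ℂ), ht, map_zero, commutator_normalize_left,
    commutator_normalize_right] at h
  simp only [complexStructure_apply, commutator_traceless_left, commutator_traceless_right]
  exact h

/-- Makes the third structure `K` integrable by the same argument as the other two. Its square is
`-Q² Q'²`, where both squares are minus the same projection. -/
lemma mul (hQ : IsAdmissible b z Q) (hQ' : IsAdmissible b z Q') (h : Q * Q' = -(Q' * Q)) :
    IsAdmissible b z (Q * Q') where
  isBlockDiag := hQ.isBlockDiag.mul hQ'.isBlockDiag
  last := hQ.last
  row j := by simp [mul_apply, hQ.row]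
  col j := by simp [mul_apply, hQ'.col]
  sq := by
    have h1 : single z z 1 * Q' = 0 := by
      ext i j
      by_cases hi : i = z <;> simp [hi, hQ'.row]
    calc Q * Q' * (Q * Q') = Q * (Q' * Q) * Q' := by simp only [Matrix.mul_assoc]
      _ = -((Q * Q) * (Q' * Q')) := by
          rw [← neg_eq_iff_eq_neg.2 h]
          simp only [Matrix.mul_assoc, Matrix.mul_neg, Matrix.neg_mul]
      _ = single z z 1 - 1 := by
          rw [hQ.sq, hQ'.sq]
          simp [Matrix.mul_sub, Matrix.sub_mul]

end IsAdmissible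

end Traceless

/-! ### Anticommuting admissible matrices in odd dimension. -/

section Existence

variable {ι κ : Type*} [Fintype ι] [DecidableEq ι] [Fintype κ] [DecidableEq κ]
  (e : ι ≃ (Fin 2 × κ) ⊕ Unit)

/-- Copies of `q` on the diagonal, followed by a zero. -/
def diagonalCopies (q : Matrix (Fin 2) (Fin 2) ℂ) : Matrix ι ι ℂ :=
  (fromBlocks (blockDiagonal fun _ : κ => q) 0 0 (0 : Matrix Unit Unit ℂ)).submatrix e e

omit [DecidableEq ι] in
lemma diagonalCopies_mul (q q' : Matrix (Fin 2) (Fin 2) ℂ) :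
    diagonalCopies e q * diagonalCopies e q' = diagonalCopies e (q * q') := by
  rw [diagonalCopies, diagonalCopies, submatrix_mul_equiv, fromBlocks_multiply, diagonalCopies,
    blockDiagonal_mul]
  simp

omit [Fintype ι] [DecidableEq ι] [Fintype κ] in
lemma diagonalCopies_neg (q : Matrix (Fin 2) (Fin 2) ℂ) :
    diagonalCopies e (-q) = -diagonalCopies e q := by
  ext i j
  rcases hi : e i with ⟨a, k⟩ | _ <;> rcases hj : e j with ⟨a', k'⟩ | _ <;>
    simp [diagonalCopies, hi, hj, blockDiagonal_apply]
  split_ifs <;> simp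

lemma isAdmissible_diagonalCopies {d : ℕ} (f : κ ≃ Fin d) {q : Matrix (Fin 2) (Fin 2) ℂ}
    (hq : q * q = -1) :
    IsAdmissible (fun i => Sum.elim (fun p => (f p.2 : ℕ)) (fun _ => d) (e i))
      (e.symm (Sum.inr ())) (diagonalCopies e q) where
  isBlockDiag i j h := by
    rcases hi : e i with ⟨a, k⟩ | _ <;> rcases hj : e j with ⟨a', k'⟩ | _ <;>
      simp_all [diagonalCopies, blockDiagonal_apply]
    rintro rfl
    exact absurd rfl h
  last j h := by
    rcases hj : e j with ⟨a, k⟩ | _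
    · simp only [Equiv.apply_symm_apply, Sum.elim_inr, hj, Sum.elim_inl] at h
      exact absurd (f k).2 (not_lt.2 h)
    · rw [← hj, Equiv.symm_apply_apply]
  row j := by
    rcases hj : e j with ⟨a, k⟩ | _ <;> simp [diagonalCopies, hj]
  col j := by
    rcases hj : e j with ⟨a, k⟩ | _ <;> simp [diagonalCopies, hj]
  sq := by
    rw [diagonalCopies_mul, hq]
    ext i j
    obtain ⟨i, rfl⟩ := e.symm.surjective i
    obtain ⟨j, rfl⟩ := e.symm.surjective j
    rcases i with ⟨a, k⟩ | _ <;> rcases j with ⟨a', k'⟩ | _ <;>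
      simp [diagonalCopies, blockDiagonal_apply, one_apply, Prod.ext_iff,
        -Fin.forall_fin_two]
    grind

end Existence

/-- There are anticommuting admissible matrices in odd dimension. -/
lemma exists_isAdmissible {m : ℕ} (hm : 1 < m) :
    ∃ (b : Fin (2 * m - 1) → ℕ) (z : Fin (2 * m - 1)) (Q Q' : Matrix _ _ ℂ),
      IsAdmissible b z Q ∧ IsAdmissible b z Q' ∧ Q * Q' = -(Q' * Q) := by
  have e : Fin (2 * m - 1) ≃ (Fin 2 × Fin (m - 1)) ⊕ Unit :=
    Fintype.equivOfCardEq (by simp; omega)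
  -- The two matrices are the quaternion units `i` and `j` acting on `ℂ²`.
  refine ⟨_, _, _, _,
    isAdmissible_diagonalCopies e (Equiv.refl _) (q := !![Complex.I, 0; 0, -Complex.I]) ?_,
    isAdmissible_diagonalCopies e (Equiv.refl _) (q := !![0, 1; -1, 0]) ?_, ?_⟩
  · ext i j; fin_cases i <;> fin_cases j <;> simp
  · ext i j; fin_cases i <;> fin_cases j <;> simp
  · rw [diagonalCopies_mul, diagonalCopies_mul, ← diagonalCopies_neg]
    congr 1
    ext i j; fin_cases i <;> fin_cases j <;> simp

end BlockComplexStructure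

open VectorField Bundle

/-! ### Tensoriality of the Nijenhuis expression. -/

section Nijenhuis

variable {E : Type*} [NormedAddCommGroup E] [NormedSpace ℝ E]
  {M : Type*} [TopologicalSpace M] [ChartedSpace E M] [IsManifold 𝓘(ℝ, E) ∞ M]
  {J : TangentEndo E M} {X X' Y Y' : ∀ x : M, TangentSpace 𝓘(ℝ, E) x} {x : M}

lemma mdifferentiableAt_tangentEndo_apply
    (hJ : ContMDiff 𝓘(ℝ, E).tangent 𝓘(ℝ, E).tangent ∞
      (fun v : TangentBundle 𝓘(ℝ, E) M => (⟨v.1, J v.1 v.2⟩ : TangentBundle 𝓘(ℝ, E) M)))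
    (hX : MDifferentiableAt 𝓘(ℝ, E) 𝓘(ℝ, E).tangent
      (fun y => (⟨y, X y⟩ : TangentBundle 𝓘(ℝ, E) M)) x) :
    MDifferentiableAt 𝓘(ℝ, E) 𝓘(ℝ, E).tangent
      (fun y => (⟨y, J y (X y)⟩ : TangentBundle 𝓘(ℝ, E) M)) x :=
  ((hJ _).mdifferentiableAt (by simp)).comp x hX

omit [IsManifold 𝓘(ℝ, E) ∞ M] in
lemma nijenhuis_swap : nijenhuis J X Y x = -nijenhuis J Y X x := by
  unfold nijenhuis
  rw [mlieBracket_swap_apply (V := fun y => J y (X y)) (W := fun y => J y (Y y)),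
    mlieBracket_swap_apply (V := X) (W := Y),
    mlieBracket_swap_apply (V := fun y => J y (X y)) (W := Y),
    mlieBracket_swap_apply (V := X) (W := fun y => J y (Y y)), map_neg, map_neg]
  abel

variable [CompleteSpace E]

/-- When `X` is replaced by `f X`, the derivatives of `f` along `J Y` cancel between the first and
the last bracket. Those along `Y` cancel between the other two because `J² = -1`. -/
lemma tensorialAt_nijenhuis_left
    (hJ : ContMDiff 𝓘(ℝ, E).tangent 𝓘(ℝ, E).tangent ∞
      (fun v : TangentBundle 𝓘(ℝ, E) M => (⟨v.1, J v.1 v.2⟩ : TangentBundle 𝓘(ℝ, E) M)))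
    (hsq : ∀ (x : M) (v : TangentSpace 𝓘(ℝ, E) x), J x (J x v) = -v)
    (Y : ∀ x : M, TangentSpace 𝓘(ℝ, E) x) :
    TensorialAt 𝓘(ℝ, E) E (fun X => nijenhuis J X Y x) x where
  smul {f X} hf hX := by
    have hM : IsManifold 𝓘(ℝ, E) (minSmoothness ℝ 2) M :=
      .of_le (n := ∞) (by simpa using (WithTop.coe_le_coe.2 le_top : ((2 : ℕ∞) : ℕ∞ω) ≤ ∞))
    have hJX := mdifferentiableAt_tangentEndo_apply hJ hX
    have h : (fun y => J y ((f • X) y)) = f • fun y => J y (X y) := by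
      ext1 y; exact map_smul _ _ _
    simp only [nijenhuis, h]
    rw [mlieBracket_smul_left hf hJX, mlieBracket_smul_left hf hX, mlieBracket_smul_left hf hJX,
      mlieBracket_smul_left hf hX]
    simp only [map_add, map_smul, hsq]
    module
  add {X X'} hX hX' := by
    have hM : IsManifold 𝓘(ℝ, E) (minSmoothness ℝ 2) M :=
      .of_le (n := ∞) (by simpa using (WithTop.coe_le_coe.2 le_top : ((2 : ℕ∞) : ℕ∞ω) ≤ ∞))
    have hJX := mdifferentiableAt_tangentEndo_apply hJ hX
    have hJX' := mdifferentiableAt_tangentEndo_apply hJ hX'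
    have h : (fun y => J y ((X + X') y)) = (fun y => J y (X y)) + fun y => J y (X' y) := by
      ext1 y; exact map_add _ _ _
    simp only [nijenhuis, h]
    rw [mlieBracket_add_left hJX hJX', mlieBracket_add_left hX hX', mlieBracket_add_left hJX hJX',
      mlieBracket_add_left hX hX']
    simp only [map_add]
    abel

lemma tensorialAt_nijenhuis_right
    (hJ : ContMDiff 𝓘(ℝ, E).tangent 𝓘(ℝ, E).tangent ∞
      (fun v : TangentBundle 𝓘(ℝ, E) M => (⟨v.1, J v.1 v.2⟩ : TangentBundle 𝓘(ℝ, E) M)))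
    (hsq : ∀ (x : M) (v : TangentSpace 𝓘(ℝ, E) x), J x (J x v) = -v)
    (X : ∀ x : M, TangentSpace 𝓘(ℝ, E) x) :
    TensorialAt 𝓘(ℝ, E) E (fun Y => nijenhuis J X Y x) x where
  smul {f Y} hf hY := by
    rw [nijenhuis_swap, nijenhuis_swap (X := X) (Y := Y),
      (tensorialAt_nijenhuis_left hJ hsq X).smul hf hY, smul_neg]
  add {Y Y'} hY hY' := by
    rw [nijenhuis_swap, nijenhuis_swap (X := X) (Y := Y), nijenhuis_swap (X := X) (Y := Y'),
      (tensorialAt_nijenhuis_left hJ hsq X).add hY hY', neg_add]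

/-- The Nijenhuis expression at a point depends only on the values of the vector fields there. -/
lemma nijenhuis_congr [FiniteDimensional ℝ E]
    (hJ : ContMDiff 𝓘(ℝ, E).tangent 𝓘(ℝ, E).tangent ∞
      (fun v : TangentBundle 𝓘(ℝ, E) M => (⟨v.1, J v.1 v.2⟩ : TangentBundle 𝓘(ℝ, E) M)))
    (hsq : ∀ (x : M) (v : TangentSpace 𝓘(ℝ, E) x), J x (J x v) = -v)
    (hX : MDifferentiableAt 𝓘(ℝ, E) 𝓘(ℝ, E).tangent
      (fun y => (⟨y, X y⟩ : TangentBundle 𝓘(ℝ, E) M)) x)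
    (hX' : MDifferentiableAt 𝓘(ℝ, E) 𝓘(ℝ, E).tangent
      (fun y => (⟨y, X' y⟩ : TangentBundle 𝓘(ℝ, E) M)) x)
    (hY : MDifferentiableAt 𝓘(ℝ, E) 𝓘(ℝ, E).tangent
      (fun y => (⟨y, Y y⟩ : TangentBundle 𝓘(ℝ, E) M)) x)
    (hY' : MDifferentiableAt 𝓘(ℝ, E) 𝓘(ℝ, E).tangent
      (fun y => (⟨y, Y' y⟩ : TangentBundle 𝓘(ℝ, E) M)) x)
    (hXX' : X x = X' x) (hYY' : Y x = Y' x) :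
    nijenhuis J X Y x = nijenhuis J X' Y' x := by
  have hM : IsManifold 𝓘(ℝ, E) (1 + 1) M := .of_le (n := ∞) (by norm_cast)
  exact TensorialAt.pointwise₂ (I := 𝓘(ℝ, E)) (F := E) (F' := E)
    (Φ := fun X Y => nijenhuis J X Y x)
    (fun Y _ => tensorialAt_nijenhuis_left hJ hsq Y)
    (fun X _ => tensorialAt_nijenhuis_right hJ hsq X) hX hX' hY hY' hXX' hYY'

end Nijenhuis

/-! ### Left-invariant endomorphism fields on a Lie group. -/

section LeftInvariant

variable {E : Type*} [NormedAddCommGroup E] [NormedSpace ℝ E]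
  {G : Type*} [TopologicalSpace G] [ChartedSpace E G] [Group G]

/-- The left-invariant field of endomorphisms with a given value at the identity. -/
def leftInvariantEndo (J₀ : GroupLieAlgebra 𝓘(ℝ, E) G →L[ℝ] GroupLieAlgebra 𝓘(ℝ, E) G) :
    TangentEndo E G := fun g =>
  (show GroupLieAlgebra 𝓘(ℝ, E) G →L[ℝ] TangentSpace 𝓘(ℝ, E) g from
      mfderiv 𝓘(ℝ, E) 𝓘(ℝ, E) (g * ·) (1 : G)) ∘L J₀ ∘L
    (show TangentSpace 𝓘(ℝ, E) g →L[ℝ] GroupLieAlgebra 𝓘(ℝ, E) G from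
      mfderiv 𝓘(ℝ, E) 𝓘(ℝ, E) (g⁻¹ * ·) g)

/-- The left translate to the identity of a tangent vector. -/
def leftTranslateToOne (g : G) (v : TangentSpace 𝓘(ℝ, E) g) : GroupLieAlgebra 𝓘(ℝ, E) G :=
  mfderiv 𝓘(ℝ, E) 𝓘(ℝ, E) (g⁻¹ * ·) g v

variable {J₀ : GroupLieAlgebra 𝓘(ℝ, E) G →L[ℝ] GroupLieAlgebra 𝓘(ℝ, E) G}

lemma leftInvariantEndo_apply (g : G) (v : TangentSpace 𝓘(ℝ, E) g) :
    leftInvariantEndo J₀ g v = mulInvariantVectorField (J₀ (leftTranslateToOne g v)) g := rfl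

variable [LieGroup 𝓘(ℝ, E) ∞ G]

lemma mdifferentiableAt_mul_left_lieGroup (g h : G) :
    MDifferentiableAt 𝓘(ℝ, E) 𝓘(ℝ, E) (g * ·) h :=
  (contMDiff_mul_left (n := ∞)).mdifferentiableAt (by simp)

lemma leftTranslateToOne_mulInvariantVectorField (g : G) (v : GroupLieAlgebra 𝓘(ℝ, E) G) :
    leftTranslateToOne g (mulInvariantVectorField v g) = v := by
  have h := mfderiv_comp_apply (I := 𝓘(ℝ, E)) (I' := 𝓘(ℝ, E)) (I'' := 𝓘(ℝ, E)) (1 : G)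
    (mdifferentiableAt_mul_left_lieGroup g⁻¹ (g * 1)) (mdifferentiableAt_mul_left_lieGroup g 1) v
  have h1 : (g⁻¹ * ·) ∘ (g * ·) = (id : G → G) := by ext x; simp
  rw [h1, mfderiv_id] at h
  rw [mul_one] at h
  exact h.symm

lemma leftTranslateToOne_mfderiv (g h : G) (v : TangentSpace 𝓘(ℝ, E) h) :
    leftTranslateToOne (g * h) (mfderiv 𝓘(ℝ, E) 𝓘(ℝ, E) (g * ·) h v) = leftTranslateToOne h v := by
  have H := mfderiv_comp_apply (I := 𝓘(ℝ, E)) (I' := 𝓘(ℝ, E)) (I'' := 𝓘(ℝ, E)) h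
    (mdifferentiableAt_mul_left_lieGroup (g * h)⁻¹ (g * h))
    (mdifferentiableAt_mul_left_lieGroup g h) v
  have h1 : ((g * h)⁻¹ * ·) ∘ (g * ·) = ((h⁻¹ * ·) : G → G) := by ext x; simp [mul_assoc]
  rw [h1] at H
  exact H.symm

lemma mfderiv_mulInvariantVectorField (g h : G) (v : GroupLieAlgebra 𝓘(ℝ, E) G) :
    mfderiv 𝓘(ℝ, E) 𝓘(ℝ, E) (g * ·) h (mulInvariantVectorField v h)
      = mulInvariantVectorField v (g * h) := by
  have H := mfderiv_comp_apply (I := 𝓘(ℝ, E)) (I' := 𝓘(ℝ, E)) (I'' := 𝓘(ℝ, E)) (1 : G)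
    (mdifferentiableAt_mul_left_lieGroup g (h * 1)) (mdifferentiableAt_mul_left_lieGroup h 1) v
  have h1 : (g * ·) ∘ (h * ·) = ((g * h * ·) : G → G) := by ext x; simp [mul_assoc]
  rw [h1, mul_one] at H
  exact H.symm

lemma mulInvariantVectorField_leftTranslateToOne (g : G) (v : TangentSpace 𝓘(ℝ, E) g) :
    mulInvariantVectorField (leftTranslateToOne g v) g = v := by
  have H := mfderiv_comp_apply (I := 𝓘(ℝ, E)) (I' := 𝓘(ℝ, E)) (I'' := 𝓘(ℝ, E)) g
    (mdifferentiableAt_mul_left_lieGroup g (g⁻¹ * g))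
    (mdifferentiableAt_mul_left_lieGroup g⁻¹ g) v
  have h1 : (g * ·) ∘ (g⁻¹ * ·) = (id : G → G) := by ext x; simp
  rw [h1, mfderiv_id, inv_mul_cancel] at H
  exact H.symm

lemma isLeftInvariant_leftInvariantEndo : IsLeftInvariant (leftInvariantEndo J₀) := by
  intro g h v
  rw [leftInvariantEndo_apply, leftInvariantEndo_apply, leftTranslateToOne_mfderiv,
    mfderiv_mulInvariantVectorField]

lemma leftInvariantEndo_mulInvariantVectorField (v : GroupLieAlgebra 𝓘(ℝ, E) G) (g : G) :
    leftInvariantEndo J₀ g (mulInvariantVectorField v g) = mulInvariantVectorField (J₀ v) g := by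
  rw [leftInvariantEndo_apply, leftTranslateToOne_mulInvariantVectorField]

omit [Group G] [LieGroup 𝓘(ℝ, E) ∞ G] in
lemma tangentBundle_mk_congr {x y : G} (h : x = y) (v : E) :
    (⟨x, v⟩ : TangentBundle 𝓘(ℝ, E) G) = ⟨y, v⟩ := by
  subst h; rfl

/-- Left translation of tangent vectors is smooth. -/
lemma contMDiff_mul_tangent {F H N : Type*} [NormedAddCommGroup F] [NormedSpace ℝ F]
    [TopologicalSpace H] {I : ModelWithCorners ℝ F H} [TopologicalSpace N] [ChartedSpace H N]
    {f : N → G} {V : N → TangentBundle 𝓘(ℝ, E) G} (hf : ContMDiff I 𝓘(ℝ, E) ∞ f)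
    (hV : ContMDiff I 𝓘(ℝ, E).tangent ∞ V) :
    ContMDiff I 𝓘(ℝ, E).tangent ∞ (fun x =>
      (⟨f x * (V x).1, mfderiv 𝓘(ℝ, E) 𝓘(ℝ, E) (f x * ·) (V x).1 (V x).2⟩ :
        TangentBundle 𝓘(ℝ, E) G)) := by
  have hM : IsManifold 𝓘(ℝ, E) (∞ + 1) G := inferInstanceAs (IsManifold 𝓘(ℝ, E) ∞ G)
  have h0 : ContMDiff I 𝓘(ℝ, E).tangent ∞
      (fun x => (⟨f x, 0⟩ : TangentBundle 𝓘(ℝ, E) G)) :=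
    (contMDiff_zeroSection ℝ (fun x : G => TangentSpace 𝓘(ℝ, E) x)).comp hf
  have h1 := contMDiff_equivTangentBundleProd_symm (n := ∞) (I := 𝓘(ℝ, E)) (I' := 𝓘(ℝ, E))
    (M := G) (M' := G)
  have h2 : ContMDiff (𝓘(ℝ, E).prod 𝓘(ℝ, E)).tangent 𝓘(ℝ, E).tangent ∞
      (tangentMap (𝓘(ℝ, E).prod 𝓘(ℝ, E)) 𝓘(ℝ, E) fun p : G × G => p.1 * p.2) :=
    ContMDiff.contMDiff_tangentMap (n := ∞) (contMDiff_mul 𝓘(ℝ, E) ∞) (by simp)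
  -- The differential of the multiplication at a pair `(0, v)` is the differential of the left
  -- translation at `v`.
  have h3 := (h2.comp h1).comp (h0.prodMk hV)
  convert! h3 with x
  simp only [Function.comp_apply, tangentMap]
  rw [mfderiv_prod_eq_add_apply ((contMDiff_mul 𝓘(ℝ, E) ∞).mdifferentiableAt (by simp))]
  exact ((congrArg (· + _) (map_zero _)).trans (zero_add _)).symm

/-- The inclusion of the tangent space at the identity into the tangent bundle is smooth. -/
lemma contMDiff_mk_one :
    ContMDiff 𝓘(ℝ, E) 𝓘(ℝ, E).tangent ∞
      (fun v : E => (⟨1, v⟩ : TangentBundle 𝓘(ℝ, E) G)) := by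
  intro v
  rw [contMDiffAt_totalSpace]
  refine ⟨contMDiffAt_const, ?_⟩
  refine contMDiffAt_id.congr_of_eventuallyEq (Filter.Eventually.of_forall fun w => ?_)
  exact tangentCoordChange_self (I := 𝓘(ℝ, E)) (mem_extChartAt_source (1 : G))

/-- Translation by `g⁻¹` is smooth into the tangent bundle and lands in the fibre over `1`, where
the trivialization at `1` is the identity; its fibre component is therefore the map in question. -/
lemma contMDiff_leftTranslateToOne :
    ContMDiff (M' := E) 𝓘(ℝ, E).tangent 𝓘(ℝ, E) ∞
      (fun v : TangentBundle 𝓘(ℝ, E) G => leftTranslateToOne v.1 v.2) := by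
  have h1 : ContMDiff 𝓘(ℝ, E).tangent 𝓘(ℝ, E) ∞ (fun v : TangentBundle 𝓘(ℝ, E) G => v.1⁻¹) :=
    (contMDiff_inv 𝓘(ℝ, E) ∞).comp (contMDiff_proj _)
  have h2 : ContMDiff 𝓘(ℝ, E).tangent 𝓘(ℝ, E).tangent ∞ (fun v : TangentBundle 𝓘(ℝ, E) G =>
      (⟨1, leftTranslateToOne v.1 v.2⟩ : TangentBundle 𝓘(ℝ, E) G)) := by
    refine (contMDiff_mul_tangent h1 contMDiff_id).congr fun v => ?_
    exact tangentBundle_mk_congr (inv_mul_cancel v.1).symm _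
  intro v
  refine (contMDiffAt_totalSpace.1 (h2 v)).2.congr_of_eventuallyEq
    (Filter.Eventually.of_forall fun w => ?_)
  exact (tangentCoordChange_self (I := 𝓘(ℝ, E)) (mem_extChartAt_source (1 : G))).symm

lemma contMDiff_mulInvariantVectorField_prod :
    ContMDiff (𝓘(ℝ, E).prod 𝓘(ℝ, E)) 𝓘(ℝ, E).tangent ∞
      (fun p : G × E => (⟨p.1, mulInvariantVectorField (I := 𝓘(ℝ, E)) p.2 p.1⟩ :
        TangentBundle 𝓘(ℝ, E) G)) := by
  refine (contMDiff_mul_tangent contMDiff_fst (contMDiff_mk_one.comp contMDiff_snd)).congr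
    fun p => ?_
  exact tangentBundle_mk_congr (mul_one p.1).symm _

lemma contMDiff_leftInvariantEndo :
    ContMDiff 𝓘(ℝ, E).tangent 𝓘(ℝ, E).tangent ∞
      (fun v : TangentBundle 𝓘(ℝ, E) G =>
        (⟨v.1, leftInvariantEndo J₀ v.1 v.2⟩ : TangentBundle 𝓘(ℝ, E) G)) := by
  have h1 : ContMDiff (M' := E) 𝓘(ℝ, E).tangent 𝓘(ℝ, E) ∞
      (fun v : TangentBundle 𝓘(ℝ, E) G => J₀ (leftTranslateToOne v.1 v.2)) :=
    (ContinuousLinearMap.contMDiff (show E →L[ℝ] E from J₀)).comp contMDiff_leftTranslateToOne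
  have h2 : ContMDiff 𝓘(ℝ, E).tangent 𝓘(ℝ, E) ∞ (fun v : TangentBundle 𝓘(ℝ, E) G => v.1) :=
    contMDiff_proj _
  exact contMDiff_mulInvariantVectorField_prod.comp (h2.prodMk h1)

lemma leftInvariantEndo_comp
    {J₁ : GroupLieAlgebra 𝓘(ℝ, E) G →L[ℝ] GroupLieAlgebra 𝓘(ℝ, E) G} (g : G)
    (v : TangentSpace 𝓘(ℝ, E) g) :
    leftInvariantEndo J₀ g (leftInvariantEndo J₁ g v)
      = mulInvariantVectorField (J₀ (J₁ (leftTranslateToOne g v))) g := by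
  rw [leftInvariantEndo_apply g v, leftInvariantEndo_mulInvariantVectorField]

lemma leftInvariantEndo_sq (hsq : ∀ v, J₀ (J₀ v) = -v) (g : G) (v : TangentSpace 𝓘(ℝ, E) g) :
    leftInvariantEndo J₀ g (leftInvariantEndo J₀ g v) = -v := by
  rw [leftInvariantEndo_comp, hsq]
  conv_rhs => rw [← mulInvariantVectorField_leftTranslateToOne g v]
  exact map_neg _ _

lemma nijenhuis_mulInvariantVectorField [CompleteSpace E] (v w : GroupLieAlgebra 𝓘(ℝ, E) G)
    (h : ⁅J₀ v, J₀ w⁆ - ⁅v, w⁆ - J₀ ⁅J₀ v, w⁆ - J₀ ⁅v, J₀ w⁆ = 0) (g : G) :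
    nijenhuis (leftInvariantEndo J₀) (mulInvariantVectorField v) (mulInvariantVectorField w) g
      = 0 := by
  have hG : LieGroup 𝓘(ℝ, E) (minSmoothness ℝ 3) G :=
      .of_le (n := ∞) (by simpa using (WithTop.coe_le_coe.2 le_top : ((3 : ℕ∞) : ℕ∞ω) ≤ ∞))
  have hb : ∀ a b : GroupLieAlgebra 𝓘(ℝ, E) G,
      mlieBracket 𝓘(ℝ, E) (mulInvariantVectorField a) (mulInvariantVectorField b) g
        = mulInvariantVectorField ⁅a, b⁆ g := fun a b =>
    congrFun (mulInvariantVector_mlieBracket a b).symm g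
  have hJ : ∀ a : GroupLieAlgebra 𝓘(ℝ, E) G,
      (fun y => leftInvariantEndo J₀ y (mulInvariantVectorField a y))
        = mulInvariantVectorField (J₀ a) := fun a =>
    funext fun y => leftInvariantEndo_mulInvariantVectorField a y
  simp only [nijenhuis, hJ]
  rw [hb, hb, hb, hb, leftInvariantEndo_mulInvariantVectorField,
    leftInvariantEndo_mulInvariantVectorField]
  have hs : ∀ a b : GroupLieAlgebra 𝓘(ℝ, E) G, mulInvariantVectorField (a - b) g
      = mulInvariantVectorField a g - mulInvariantVectorField b g := fun a b => map_sub _ a b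
  rw [← hs, ← hs, ← hs, h]
  exact map_zero _

/-- A complex structure on the Lie algebra extends to a left-invariant one on the Lie group. -/
lemma isComplexStructure_leftInvariantEndo [FiniteDimensional ℝ E]
    (hsq : ∀ v, J₀ (J₀ v) = -v)
    (hint : ∀ v w : GroupLieAlgebra 𝓘(ℝ, E) G,
      ⁅J₀ v, J₀ w⁆ - ⁅v, w⁆ - J₀ ⁅J₀ v, w⁆ - J₀ ⁅v, J₀ w⁆ = 0) :
    IsComplexStructure (leftInvariantEndo J₀) where
  smooth := contMDiff_leftInvariantEndo
  sq_eq_neg := leftInvariantEndo_sq hsq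
  integrable X Y hX hY g := by
    have hG : LieGroup 𝓘(ℝ, E) (minSmoothness ℝ 3) G :=
      .of_le (n := ∞) (by simpa using (WithTop.coe_le_coe.2 le_top : ((3 : ℕ∞) : ℕ∞ω) ≤ ∞))
    have := FiniteDimensional.complete ℝ E
    -- By tensoriality, `X` and `Y` may be replaced by the left-invariant fields with the same
    -- values at `g`.
    rw [← nijenhuis_mulInvariantVectorField (leftTranslateToOne g (X g))
      (leftTranslateToOne g (Y g)) (hint _ _) g]
    exact nijenhuis_congr contMDiff_leftInvariantEndo (leftInvariantEndo_sq hsq)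
      (hX.mdifferentiable (by simp) g)
      (mdifferentiableAt_mulInvariantVectorField _) (hY.mdifferentiable (by simp) g)
      (mdifferentiableAt_mulInvariantVectorField _)
      (mulInvariantVectorField_leftTranslateToOne g _).symm
      (mulInvariantVectorField_leftTranslateToOne g _).symm

end LeftInvariant

/-! ### Lie brackets of vector fields as commutators of derivations. -/

section Derivations

variable {E : Type*} [NormedAddCommGroup E] [NormedSpace ℝ E] [CompleteSpace E]
  {F : Type*} [NormedAddCommGroup F] [NormedSpace ℝ F]
  {M : Type*} [TopologicalSpace M] [ChartedSpace E M] [IsManifold 𝓘(ℝ, E) ∞ M]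

/-- The derivative along a Lie bracket is the commutator of the derivatives. -/
lemma mfderiv_apply_mlieBracket {f : M → F} (hf : ContMDiff 𝓘(ℝ, E) 𝓘(ℝ, F) ∞ f)
    {V W : ∀ x : M, TangentSpace 𝓘(ℝ, E) x} {DV DW : M → F}
    (hDV : ∀ y, mfderiv 𝓘(ℝ, E) 𝓘(ℝ, F) f y (V y) = DV y)
    (hDW : ∀ y, mfderiv 𝓘(ℝ, E) 𝓘(ℝ, F) f y (W y) = DW y)
    (hDVs : MDifferentiable 𝓘(ℝ, E) 𝓘(ℝ, F) DV) (hDWs : MDifferentiable 𝓘(ℝ, E) 𝓘(ℝ, F) DW)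
    {x : M}
    (hV : MDifferentiableAt 𝓘(ℝ, E) 𝓘(ℝ, E).tangent
      (fun y => (⟨y, V y⟩ : TangentBundle 𝓘(ℝ, E) M)) x)
    (hW : MDifferentiableAt 𝓘(ℝ, E) 𝓘(ℝ, E).tangent
      (fun y => (⟨y, W y⟩ : TangentBundle 𝓘(ℝ, E) M)) x)
    {a b : F} (ha : mfderiv 𝓘(ℝ, E) 𝓘(ℝ, F) DW x (V x) = a)
    (hb : mfderiv 𝓘(ℝ, E) 𝓘(ℝ, F) DV x (W x) = b) :
    mfderiv 𝓘(ℝ, E) 𝓘(ℝ, F) f x (mlieBracket 𝓘(ℝ, E) V W x) = a - b := by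
  have hM : IsManifold 𝓘(ℝ, E) 2 M := .of_le (n := ∞) (WithTop.coe_le_coe.2 le_top : ((2 : ℕ∞) : ℕ∞ω) ≤ ∞)
  have hM1 : IsManifold 𝓘(ℝ, E) 1 M := .of_le (n := ∞) (mod_cast (le_top : (1 : ℕ∞) ≤ ⊤))
  set φ := extChartAt 𝓘(ℝ, E) x with hφ
  have hr : Set.range (𝓘(ℝ, E) : E → E) = Set.univ := Set.range_id
  have hnhds : φ.target ∈ nhds (φ x) := extChartAt_target_mem_nhds x
  have hx : φ.symm (φ x) = x := extChartAt_to_inv x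
  -- The field `Z` read in the chart at `x`, which reduces the claim to `fderiv_apply_lieBracket` in
  -- the model space.
  let p : (∀ x : M, TangentSpace 𝓘(ℝ, E) x) → E → E := fun Z =>
    mpullbackWithin 𝓘(ℝ, E) 𝓘(ℝ, E) φ.symm Z (Set.range 𝓘(ℝ, E))
  have key : ∀ {g : M → F}, MDifferentiable 𝓘(ℝ, E) 𝓘(ℝ, F) g →
      ∀ (Z : ∀ x : M, TangentSpace 𝓘(ℝ, E) x), ∀ y ∈ φ.target,
      fderiv ℝ (g ∘ φ.symm) y (p Z y) = mfderiv 𝓘(ℝ, E) 𝓘(ℝ, F) g (φ.symm y) (Z (φ.symm y)) := by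
    intro g hg Z y hy
    have hinv : (mfderivWithin 𝓘(ℝ, E) 𝓘(ℝ, E) φ.symm (Set.range 𝓘(ℝ, E)) y).IsInvertible :=
      isInvertible_mfderivWithin_extChartAt_symm hy
    have hs : MDifferentiableAt 𝓘(ℝ, E) 𝓘(ℝ, E) φ.symm y := by
      have := mdifferentiableWithinAt_extChartAt_symm hy
      rwa [hr, mdifferentiableWithinAt_univ] at this
    have h := mfderiv_comp_apply y (hg _) hs
      (mpullbackWithin 𝓘(ℝ, E) 𝓘(ℝ, E) φ.symm Z (Set.range 𝓘(ℝ, E)) y)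
    rw [mfderiv_eq_fderiv] at h
    refine h.trans ?_
    have h2 : mfderiv 𝓘(ℝ, E) 𝓘(ℝ, E) φ.symm y
        = mfderivWithin 𝓘(ℝ, E) 𝓘(ℝ, E) φ.symm (Set.range 𝓘(ℝ, E)) y := by
      rw [hr, mfderivWithin_univ]
    rw [h2, mpullbackWithin_apply, hinv.self_apply_inverse]
  have hset : φ.symm ⁻¹' Set.univ ∩ Set.range (𝓘(ℝ, E) : E → E) = Set.univ := by
    rw [hr, Set.preimage_univ, Set.univ_inter]
  have hbr : mlieBracket 𝓘(ℝ, E) V W x = lieBracket ℝ (p V) (p W) (φ x) := by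
    rw [← mlieBracketWithin_univ, mlieBracketWithin_apply, mfderiv_extChartAt_self,
      ← lieBracketWithin_univ, ← hset]
    exact DFunLike.congr_fun (ContinuousLinearMap.inverse_id (R := ℝ) (M := E)) _
  have hf1 : ∀ v : E, mfderiv 𝓘(ℝ, E) 𝓘(ℝ, F) f x v = fderiv ℝ (f ∘ φ.symm) (φ x) v := by
    intro v
    rw [(hf.mdifferentiable (by simp) x).mfderiv, hr, fderivWithin_univ]
    rfl
  have hf' : ContDiffAt ℝ ∞ (f ∘ φ.symm) (φ x) :=
    ((hf.comp_contMDiffOn (contMDiffOn_extChartAt_symm x)).contMDiffAt hnhds).contDiffAt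
  have hdiff : ∀ {Z : ∀ x : M, TangentSpace 𝓘(ℝ, E) x}, MDifferentiableAt 𝓘(ℝ, E) 𝓘(ℝ, E).tangent
      (fun y => (⟨y, Z y⟩ : TangentBundle 𝓘(ℝ, E) M)) x → DifferentiableAt ℝ (p Z) (φ x) := by
    intro Z hZ
    have h : DifferentiableWithinAt ℝ (p Z) (φ.symm ⁻¹' Set.univ ∩ Set.range 𝓘(ℝ, E)) (φ x) :=
      hZ.mdifferentiableWithinAt (s := Set.univ)
        |>.differentiableWithinAt_mpullbackWithin_vectorField
    rwa [hset, differentiableWithinAt_univ] at h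
  have hD : ∀ {Z : ∀ x : M, TangentSpace 𝓘(ℝ, E) x} {DZ : M → F},
      (∀ y, mfderiv 𝓘(ℝ, E) 𝓘(ℝ, F) f y (Z y) = DZ y) →
      (fun y => fderiv ℝ (f ∘ φ.symm) y (p Z y)) =ᶠ[nhds (φ x)] DZ ∘ φ.symm := by
    intro Z DZ h
    filter_upwards [hnhds] with y hy
    exact (key (hf.mdifferentiable (by simp)) Z y hy).trans (h _)
  have hc := fderiv_apply_lieBracket hf'
    (by simpa using (WithTop.coe_le_coe.2 le_top : ((2 : ℕ∞) : ℕ∞ω) ≤ ∞)) (hdiff hW) (hdiff hV)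
  rw [(hD hDV).fderiv_eq, (hD hDW).fderiv_eq, key hDWs V _ (mem_extChartAt_target x),
    key hDVs W _ (mem_extChartAt_target x), hx, ha, hb] at hc
  rw [hbr]
  exact (hf1 _).trans hc

end Derivations

/-! ### The Lie algebra of `SL(n, ℂ)` as traceless matrices. -/

namespace SLManifold

open Matrix VectorField

section Determinant

variable {n : ℕ}

lemma hasDerivAt_det_one_add_smul (X : Matrix (Fin n) (Fin n) ℂ) :
    HasDerivAt (fun t : ℝ => (1 + t • X).det) X.trace 0 := by
  have h : HasDerivAt (fun t : ℂ => (1 + t • X).det) X.trace ((0 : ℝ) : ℂ) := by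
    obtain ⟨p, hp⟩ : ∃ p : Polynomial ℂ, ∀ t : ℂ,
        (1 + t • X).det = 1 + X.trace * t + p.eval t * t ^ 2 := ⟨_, fun t => det_one_add_smul t X⟩
    simp_rw [hp]
    have h1 := ((hasDerivAt_id ((0 : ℝ) : ℂ)).const_mul X.trace).const_add 1
    have h2 := (p.hasDerivAt ((0 : ℝ) : ℂ)).mul (hasDerivAt_pow 2 ((0 : ℝ) : ℂ))
    exact (h1.add h2).congr_deriv (by simp)
  simpa using h.comp_ofReal

lemma fderiv_det_one (X : Fin n → Fin n → ℂ) :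
    fderiv ℝ (fun A : Fin n → Fin n → ℂ => Matrix.det (of A)) (1 : Matrix (Fin n) (Fin n) ℂ) X
      = Matrix.trace (of X) := by
  have hd : ContDiff ℝ ∞ (fun A : Fin n → Fin n → ℂ => Matrix.det (of A)) :=
    contDiff_det fun i j => contDiff_apply_apply ℝ ℂ i j
  let l : ℝ → Fin n → Fin n → ℂ := fun t =>
    (show Fin n → Fin n → ℂ from (1 : Matrix (Fin n) (Fin n) ℂ)) + t • X
  have hl : HasDerivAt l X 0 := by
    have := ((hasDerivAt_id (0 : ℝ)).smul_const X).const_add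
      (show Fin n → Fin n → ℂ from (1 : Matrix (Fin n) (Fin n) ℂ))
    rwa [one_smul] at this
  have hl0 : l 0 = (1 : Matrix (Fin n) (Fin n) ℂ) := by
    simp only [l, zero_smul]
    exact add_zero _
  have h := ((hd.differentiable (by simp)) (l 0)).hasFDerivAt.comp_hasDerivAt 0 hl
  rw [hl0] at h
  exact h.unique (hasDerivAt_det_one_add_smul (of X))

end Determinant

variable {n : ℕ} [NeZero n]

/-- The matrix entries of an element of `SL(n, ℂ)`. -/
def entries (A : SpecialLinearGroup (Fin n) ℂ) : Fin n → Fin n → ℂ := mat A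

lemma contMDiff_entries :
    ContMDiff 𝓘(ℝ, Coords n) 𝓘(ℝ, Fin n → Fin n → ℂ) ∞
      (entries : SpecialLinearGroup (Fin n) ℂ → _) := by
  rw [contMDiff_pi_space]
  intro i
  rw [contMDiff_pi_space]
  exact contMDiff_mat i

lemma mdifferentiable_entries :
    MDifferentiable 𝓘(ℝ, Coords n) 𝓘(ℝ, Fin n → Fin n → ℂ)
      (entries : SpecialLinearGroup (Fin n) ℂ → _) :=
  contMDiff_entries.mdifferentiable (by simp)

/-- The differential at the identity of the inclusion of `SL(n, ℂ)` into the space of matrices. -/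
def dMat : GroupLieAlgebra 𝓘(ℝ, Coords n) (SpecialLinearGroup (Fin n) ℂ) →ₗ[ℝ]
    Matrix (Fin n) (Fin n) ℂ :=
  (mfderiv 𝓘(ℝ, Coords n) 𝓘(ℝ, Fin n → Fin n → ℂ) entries
    (1 : SpecialLinearGroup (Fin n) ℂ)).toLinearMap

/-- An endomorphism of the space of matrices, as a continuous linear map. -/
def matrixCLM (T : Matrix (Fin n) (Fin n) ℂ →ₗ[ℝ] Matrix (Fin n) (Fin n) ℂ) :
    (Fin n → Fin n → ℂ) →L[ℝ] (Fin n → Fin n → ℂ) :=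
  LinearMap.toContinuousLinearMap (show (Fin n → Fin n → ℂ) →ₗ[ℝ] (Fin n → Fin n → ℂ) from T)

/-- All entries but the upper left one, as a linear map. -/
def coordsLM : Matrix (Fin n) (Fin n) ℂ →ₗ[ℝ] Coords n where
  toFun := coords
  map_add' _ _ := rfl
  map_smul' _ _ := rfl

/-- The chart at `1` is the linear map `coords` after the inclusion into matrices, and a preferred
chart has the identity as its differential at its base point. -/
lemma coords_dMat (v : GroupLieAlgebra 𝓘(ℝ, Coords n) (SpecialLinearGroup (Fin n) ℂ)) :
    coords (dMat v) = v := by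
  let c : (Fin n → Fin n → ℂ) →L[ℝ] Coords n := LinearMap.toContinuousLinearMap
    (show (Fin n → Fin n → ℂ) →ₗ[ℝ] Coords n from coordsLM)
  have h := mfderiv_comp_apply (I := 𝓘(ℝ, Coords n)) (I' := 𝓘(ℝ, Fin n → Fin n → ℂ))
    (I'' := 𝓘(ℝ, Coords n)) (1 : SpecialLinearGroup (Fin n) ℂ) (g := c)
    c.differentiableAt.mdifferentiableAt (mdifferentiable_entries 1) v
  have hc : c ∘ entries = extChartAt 𝓘(ℝ, Coords n) (1 : SpecialLinearGroup (Fin n) ℂ) := by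
    ext A : 1
    change coords (mat A) = chart 1 A
    rw [chart_apply, inv_one, one_mul]
  rw [hc, mfderiv_extChartAt_self, mfderiv_eq_fderiv, c.fderiv] at h
  exact h.symm

/-- Differentiate `det = 1` at the identity. -/
lemma trace_dMat (v : GroupLieAlgebra 𝓘(ℝ, Coords n) (SpecialLinearGroup (Fin n) ℂ)) :
    (dMat v).trace = 0 := by
  let d : (Fin n → Fin n → ℂ) → ℂ := fun A => Matrix.det (of A)
  have hd : ContDiff ℝ ∞ d := contDiff_det fun i j => contDiff_apply_apply ℝ ℂ i j
  have h := mfderiv_comp_apply (I := 𝓘(ℝ, Coords n)) (I' := 𝓘(ℝ, Fin n → Fin n → ℂ))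
    (I'' := 𝓘(ℝ, ℂ)) (1 : SpecialLinearGroup (Fin n) ℂ) (g := d)
    (hd.differentiable (by simp) _).mdifferentiableAt (mdifferentiable_entries 1) v
  have hc : d ∘ entries = fun _ => 1 := by
    ext A : 1
    exact det_mat A
  rw [hc, mfderiv_const, mfderiv_eq_fderiv] at h
  exact (fderiv_det_one _).symm.trans h.symm

lemma eq_of_coords_eq {X Y : Matrix (Fin n) (Fin n) ℂ} (hX : X.trace = 0) (hY : Y.trace = 0)
    (h : coords X = coords Y) : X = Y := by
  have h1 : ∀ i j, (i, j) ≠ ((0 : Fin n), (0 : Fin n)) → X i j = Y i j := fun i j hij =>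
    congrFun h ⟨(i, j), hij⟩
  have h0 : X 0 0 = Y 0 0 := by
    have h2 := hX.trans hY.symm
    rw [trace, trace, Fintype.sum_eq_add_sum_compl 0, Fintype.sum_eq_add_sum_compl 0,
      Finset.sum_congr rfl fun i hi => ?_] at h2
    · exact add_right_cancel h2
    · exact h1 i i fun hi' => by simp_all
  ext i j
  by_cases hij : (i, j) = ((0 : Fin n), (0 : Fin n))
  · simp only [Prod.mk.injEq] at hij
    rw [hij.1, hij.2, h0]
  · exact h1 i j hij

lemma dMat_coords {X : Matrix (Fin n) (Fin n) ℂ} (hX : X.trace = 0) : dMat (coords X) = X :=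
  eq_of_coords_eq (trace_dMat _) hX (coords_dMat _)

lemma dMat_injective : Function.Injective (dMat (n := n)) :=
  Function.LeftInverse.injective coords_dMat

/-- Left translation by `g` is the restriction of a linear map of matrices, so in matrix terms the
left-invariant field of `v` is `g ↦ g * dMat v`. -/
lemma mfderiv_entries_mulInvariantVectorField
    (v : GroupLieAlgebra 𝓘(ℝ, Coords n) (SpecialLinearGroup (Fin n) ℂ))
    (g : SpecialLinearGroup (Fin n) ℂ) :
    mfderiv 𝓘(ℝ, Coords n) 𝓘(ℝ, Fin n → Fin n → ℂ) entries g (mulInvariantVectorField v g)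
      = matrixCLM (LinearMap.mulRight ℝ (dMat v)) (entries g) := by
  have h1 := mfderiv_comp_apply (I := 𝓘(ℝ, Coords n)) (I' := 𝓘(ℝ, Coords n))
    (I'' := 𝓘(ℝ, Fin n → Fin n → ℂ)) (1 : SpecialLinearGroup (Fin n) ℂ) (g := entries)
    (mdifferentiable_entries (g * 1)) (mdifferentiableAt_mul_left_lieGroup g 1) v
  let c := matrixCLM (LinearMap.mulLeft ℝ (mat g))
  have h2 := mfderiv_comp_apply (I := 𝓘(ℝ, Coords n)) (I' := 𝓘(ℝ, Fin n → Fin n → ℂ))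
    (I'' := 𝓘(ℝ, Fin n → Fin n → ℂ)) (1 : SpecialLinearGroup (Fin n) ℂ) (g := c)
    c.differentiableAt.mdifferentiableAt (mdifferentiable_entries 1) v
  have h3 : entries ∘ (g * ·) = c ∘ entries := rfl
  rw [h3, mul_one] at h1
  rw [mfderiv_eq_fderiv, c.fderiv] at h2
  exact h1.symm.trans h2

/-- With `A = dMat v` and `B = dMat w`, the derivative of `g ↦ g B` at `1` along `A` is `A B`;
`mfderiv_apply_mlieBracket` then gives `A B - B A`. -/
lemma dMat_lie (v w : GroupLieAlgebra 𝓘(ℝ, Coords n) (SpecialLinearGroup (Fin n) ℂ)) :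
    dMat ⁅v, w⁆ = dMat v * dMat w - dMat w * dMat v := by
  have hG : LieGroup 𝓘(ℝ, Coords n) (minSmoothness ℝ 3) (SpecialLinearGroup (Fin n) ℂ) :=
    .of_le (n := ∞) (by simpa using (WithTop.coe_le_coe.2 le_top : ((3 : ℕ∞) : ℕ∞ω) ≤ ∞))
  have hdiff : ∀ c : (Fin n → Fin n → ℂ) →L[ℝ] (Fin n → Fin n → ℂ),
      MDifferentiable 𝓘(ℝ, Coords n) 𝓘(ℝ, Fin n → Fin n → ℂ)
        fun g : SpecialLinearGroup (Fin n) ℂ => c (entries g) := fun c g =>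
    c.differentiableAt.mdifferentiableAt.comp g (mdifferentiable_entries g)
  have hval : ∀ a b : GroupLieAlgebra 𝓘(ℝ, Coords n) (SpecialLinearGroup (Fin n) ℂ),
      mfderiv 𝓘(ℝ, Coords n) 𝓘(ℝ, Fin n → Fin n → ℂ)
        (fun g => matrixCLM (LinearMap.mulRight ℝ (dMat b)) (entries g))
        (1 : SpecialLinearGroup (Fin n) ℂ) (mulInvariantVectorField a 1)
        = dMat a * dMat b := by
    intro a b
    let c := matrixCLM (LinearMap.mulRight ℝ (dMat b))
    have h := mfderiv_comp_apply (I := 𝓘(ℝ, Coords n)) (I' := 𝓘(ℝ, Fin n → Fin n → ℂ))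
      (I'' := 𝓘(ℝ, Fin n → Fin n → ℂ)) (1 : SpecialLinearGroup (Fin n) ℂ) (g := c)
      c.differentiableAt.mdifferentiableAt (mdifferentiable_entries 1)
      (mulInvariantVectorField a 1)
    rw [mfderiv_eq_fderiv, c.fderiv, mfderiv_entries_mulInvariantVectorField] at h
    refine h.trans ?_
    change mat 1 * dMat a * dMat b = _
    rw [mat_one, one_mul]
  exact mfderiv_apply_mlieBracket contMDiff_entries (mfderiv_entries_mulInvariantVectorField v)
    (mfderiv_entries_mulInvariantVectorField w) (hdiff _) (hdiff _)
    (mdifferentiableAt_mulInvariantVectorField v) (mdifferentiableAt_mulInvariantVectorField w)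
    (hval v w) (hval w v)

/-- The endomorphism of the Lie algebra of `SL(n, ℂ)` that corresponds to an endomorphism of the
space of matrices which preserves tracelessness. -/
def lieAlgebraEndo (J : Matrix (Fin n) (Fin n) ℂ →ₗ[ℂ] Matrix (Fin n) (Fin n) ℂ) :
    GroupLieAlgebra 𝓘(ℝ, Coords n) (SpecialLinearGroup (Fin n) ℂ) →L[ℝ]
      GroupLieAlgebra 𝓘(ℝ, Coords n) (SpecialLinearGroup (Fin n) ℂ) :=
  show Coords n →L[ℝ] Coords n from
    LinearMap.toContinuousLinearMap (coordsLM ∘ₗ J.restrictScalars ℝ ∘ₗ dMat)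

lemma dMat_lieAlgebraEndo {J : Matrix (Fin n) (Fin n) ℂ →ₗ[ℂ] Matrix (Fin n) (Fin n) ℂ}
    (hJ : ∀ X, (J X).trace = 0)
    (v : GroupLieAlgebra 𝓘(ℝ, Coords n) (SpecialLinearGroup (Fin n) ℂ)) :
    dMat (lieAlgebraEndo J v) = J (dMat v) :=
  dMat_coords (hJ _)

/-! ### The invariant hypercomplex structure on `SL(n, ℂ)`. -/

open BlockComplexStructure

variable {b : Fin n → ℕ} {z : Fin n} {Q Q' : Matrix (Fin n) (Fin n) ℂ}

/-- The left-invariant field of endomorphisms of `SL(n, ℂ)` given by an admissible matrix. -/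
def invariantComplexStructure (b : Fin n → ℕ) (z : Fin n) (Q : Matrix (Fin n) (Fin n) ℂ) :
    TangentEndo (Coords n) (SpecialLinearGroup (Fin n) ℂ) :=
  leftInvariantEndo (lieAlgebraEndo (complexStructure b z Q))

lemma isComplexStructure_invariantComplexStructure (hQ : IsAdmissible b z Q) :
    IsComplexStructure (invariantComplexStructure b z Q) := by
  refine isComplexStructure_leftInvariantEndo (fun v => ?_) fun v w => ?_
  · apply dMat_injective
    rw [dMat_lieAlgebraEndo trace_complexStructure, dMat_lieAlgebraEndo trace_complexStructure,
      hQ.complexStructure_sq (trace_dMat v), map_neg]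
  · apply dMat_injective
    simp only [map_sub, dMat_lie, dMat_lieAlgebraEndo trace_complexStructure, map_zero]
    simpa only [map_sub] using hQ.complexStructure_integrable (dMat v) (dMat w)

lemma isHypercomplexStructure_invariantComplexStructure (hQ : IsAdmissible b z Q)
    (hQ' : IsAdmissible b z Q') (h : Q * Q' = -(Q' * Q)) :
    IsHypercomplexStructure (invariantComplexStructure b z Q) (invariantComplexStructure b z Q')
      (invariantComplexStructure b z (Q * Q')) where
  isComplexStructure_I := isComplexStructure_invariantComplexStructure hQ
  isComplexStructure_J := isComplexStructure_invariantComplexStructure hQ'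
  isComplexStructure_K := isComplexStructure_invariantComplexStructure (hQ.mul hQ' h)
  I_J g v := by
    rw [invariantComplexStructure, invariantComplexStructure, leftInvariantEndo_comp]
    refine congrArg (mulInvariantVectorField · g) (dMat_injective ?_)
    simp only [dMat_lieAlgebraEndo trace_complexStructure]
    exact (hQ'.complexStructure_mul h).trans (dMat_lieAlgebraEndo trace_complexStructure _).symm
  J_I g v := by
    rw [invariantComplexStructure, invariantComplexStructure, leftInvariantEndo_comp]
    refine (congrArg (mulInvariantVectorField · g) (dMat_injective ?_)).trans (map_neg _ _)
    simp only [map_neg, dMat_lieAlgebraEndo trace_complexStructure]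
    exact (hQ.complexStructure_mul_swap h).trans
      (congrArg Neg.neg (dMat_lieAlgebraEndo trace_complexStructure _).symm)

end SLManifold

end

theorem corollary1p3 (m : ℕ) (hm : 1 < m) :
    haveI : NeZero (2 * m - 1) := ⟨by omega⟩
    AdmitsHomogeneousHypercomplexStructure (SLManifold.Coords (2 * m - 1))
      (Matrix.SpecialLinearGroup (Fin (2 * m - 1)) ℂ) := by
  obtain ⟨b, z, Q, Q', hQ, hQ', h⟩ := BlockComplexStructure.exists_isAdmissible hm
  have : NeZero (2 * m - 1) := ⟨by omega⟩
  exact ⟨_, _, _, SLManifold.isHypercomplexStructure_invariantComplexStructure hQ hQ' h,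
    isLeftInvariant_leftInvariantEndo, isLeftInvariant_leftInvariantEndo,
    isLeftInvariant_leftInvariantEndo⟩
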